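/- Let $\mathbb{K}$ be an algebraically closed field of characteristic $0$, let $p\in\mathbb{K}[x,y]\setminus(\mathbb{K}[x]\cup\mathbb{K}[y])$ be irreducible, and let $r\in\mathbb{K}(x,y)$. Write $\mathbb{K}[x,y]_p$ for the ring of rational functions whose reduced denominator is not divisible by $p$, $\langle p\rangle$ for the ideal of $\mathbb{K}[x,y]_p$ generated by $p$, and $$\mathrm{F}(r,p)=\{(f,g)\in\mathbb{K}(x)\times\mathbb{K}(y) : f-g\in r+\langle p\rangle\}.$$ Let $C\subset\mathbb{P}^1(\mathbb{K})\times\mathbb{P}^1(\mathbb{K})$ be the zero set of the bi-homogenization $x_0^{\deg_x p}\,y_0^{\deg_y p}\,p(x_1/x_0,y_1/y_0)$ of $p$. Poles. The point $(\infty,\infty)$ is a pole of $r$ on the curve associated with $p$ if there is a Puiseux series $\varphi$ over $\mathbb{K}$ in $x^{-1}$ such that $p(x,\varphi)=0$, $\deg\varphi>0$, and $r(x,\varphi)$ is defined with $\deg r(x,\varphi)>0$, where $\deg$ is the largest exponent of $x$. A point $(s_1,s_2)\in C$ is a pole of $r$ if there are fractional linear transformations $T_1,T_2$ of $\mathbb{P}^1(\mathbb{K})$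 such that $T=(T_1,T_2)$ maps $(s_1,s_2)$ to $(\infty,\infty)$ and $(\infty,\infty)$ is a pole of $r\circ T^{-1}$ on the curve associated with the numerator of $p\circ T^{-1}$. Paths. The orbit of a point of $C$ is its class under the smallest equivalence relation on $C$ that relates any two points sharing their first or their second coordinate. The graph of the orbit has the points of the orbit as vertices, two different ones being adjacent if they share a coordinate. An infinite path is a sequence $v_0,v_1,\dots$ of vertices any two consecutive ones of which are adjacent; it is cycle-free if $v_i\neq v_j$ for all $i<j$. Assume that $(s_1,s_2)\in C$ is a pole of $r$, and that $v_0,v_1,\dots$ and $\tilde v_0,\tilde v_1,\dots$ are infinite cycle-free paths in the graph of its orbit that start at $(s_1,s_2)$ and do not contain any other pole of $r$. If the first coordinate of $v_1$ equals $s_1$ and the second coordinate of $\tilde v_1$ equals $s_2$, then $\mathrm{F}(r,p)=\emptyset$. -/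

import Mathlib

noncomputable section

namespace SepVar

universe u

/-- The polynomial ring `K[x, y]`; the variable `x` is `X 0` and `y` is `X 1`. -/
abbrev Poly (K : Type u) [Field K] : Type u := MvPolynomial (Fin 2) K

/-- The field `K(x, y)`. -/
abbrev Rat2 (K : Type u) [Field K] : Type u := FractionRing (Poly K)

variable {K : Type u} [Field K]

/-- `x` as an element of `K(x, y)`. -/
def xvar (K : Type u) [Field K] : Rat2 K := algebraMap (Poly K) (Rat2 K) (MvPolynomial.X 0)

/-- `y` as an element of `K(x, y)`. -/
def yvar (K : Type u) [Field K] : Rat2 K := algebraMap (Poly K) (Rat2 K) (MvPolynomial.X 1)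

/-- The subfield `K(x)` of `K(x, y)`. -/
abbrev Kx (K : Type u) [Field K] : IntermediateField K (Rat2 K) :=
  IntermediateField.adjoin K {xvar K}

/-- The subfield `K(y)` of `K(x, y)`. -/
abbrev Ky (K : Type u) [Field K] : IntermediateField K (Rat2 K) :=
  IntermediateField.adjoin K {yvar K}

/-- The numerator of `r` in reduced form. -/
def numer (r : Rat2 K) : Poly K := IsFractionRing.num (Poly K) r

/-- The denominator of `r` in reduced form. -/
def denom (r : Rat2 K) : Poly K := (IsFractionRing.den (Poly K) r : Poly K)

/-- The (underlying set of the) local ring `K[x, y]_p`: the rational functions whose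
denominator is not divisible by `p`. -/
def localRing (p : Poly K) : Set (Rat2 K) := {q | ¬ p ∣ denom q}

/-- The (underlying set of the) ideal `⟨p⟩` that `p` generates in `K[x, y]_p`. -/
def idealOf (p : Poly K) : Set (Rat2 K) :=
  {h | ∃ q ∈ localRing p, h = q * algebraMap (Poly K) (Rat2 K) p}

/-- `F(r, p)`: the pairs `(f, g)` in `K(x) × K(y)` with `f - g ∈ r + ⟨p⟩`. -/
def F (r : Rat2 K) (p : Poly K) : Set (Kx K × Ky K) :=
  {fg | ∃ h ∈ idealOf p, (fg.1 : Rat2 K) - (fg.2 : Rat2 K) = r + h}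

/-! ### The curve in `ℙ¹ × ℙ¹`; `ℙ¹(K)` is `OnePoint K`, that is `K ∪ {∞}` -/

/-- The bi-homogenization of `p`: the variables `X (0, 0), X (0, 1)` are `x₀, x₁`, the
variables `X (1, 0), X (1, 1)` are `y₀, y₁`, and `x = x₁ / x₀`, `y = y₁ / y₀`. -/
def biHomogenization (p : Poly K) : MvPolynomial (Fin 2 × Fin 2) K :=
  ∑ m ∈ p.support, MvPolynomial.C (p.coeff m)
    * (MvPolynomial.X (0, 0) ^ (p.degreeOf 0 - m 0) * MvPolynomial.X (0, 1) ^ m 0)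
    * (MvPolynomial.X (1, 0) ^ (p.degreeOf 1 - m 1) * MvPolynomial.X (1, 1) ^ m 1)

/-- Homogeneous coordinates: `(1 : a)` for `a` in `K`, and `(0 : 1)` for `∞`. -/
def homCoords : OnePoint K → Fin 2 → K
  | none => ![0, 1]
  | some a => ![1, a]

/-- The curve in `ℙ¹ × ℙ¹` associated with `p`, the zero set of the bi-homogenization. -/
def curve (p : Poly K) : Set (OnePoint K × OnePoint K) :=
  {s | MvPolynomial.eval
    (fun i : Fin 2 × Fin 2 => if i.1 = 0 then homCoords s.1 i.2 else homCoords s.2 i.2)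
    (biHomogenization p) = 0}

/-! ### Puiseux series in `x⁻¹` -/

/-- A Hahn series `∑ c_q t ^ q`, `q` rational, is a Puiseux series if its exponents have a common
denominator. Here the variable `t` plays the role of `x⁻¹`. -/
def IsPuiseux (φ : HahnSeries ℚ K) : Prop :=
  ∃ n : ℕ, 0 < n ∧ ∀ q ∈ φ.support, ∃ m : ℤ, q = (m : ℚ) / (n : ℚ)

/-- The degree in `x` of a series in `x⁻¹`, with `deg 0 = -∞`. -/
def deg (φ : HahnSeries ℚ K) : WithBot ℚ :=
  open Classical in if φ = 0 then ⊥ else ((-φ.order : ℚ) : WithBot ℚ)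

/-- `x` as a series in `x⁻¹`. -/
def xSeries (K : Type u) [Field K] : HahnSeries ℚ K := HahnSeries.single (-1 : ℚ) (1 : K)

/-- `r(u, v)`, for `u, v` in an extension field of `K` where the denominator of `r` does not
vanish. (Where it vanishes the value is `0`.) -/
def evalAt {L : Type*} [Field L] [Algebra K L] (u v : L) (r : Rat2 K) : L :=
  MvPolynomial.aeval ![u, v] (numer r) / MvPolynomial.aeval ![u, v] (denom r)

/-! ### Poles -/

/-- `(∞, ∞)` is a pole of `r` on the curve associated with `p`. -/
def IsPoleAtInfty (r : Rat2 K) (p : Poly K) : Prop :=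
  ∃ φ : HahnSeries ℚ K, IsPuiseux φ ∧ MvPolynomial.aeval ![xSeries K, φ] p = 0 ∧
    0 < deg φ ∧ 0 < deg (evalAt (xSeries K) φ r)

/-- The fractional linear transformation `z ↦ (a z + b) / (c z + d)` applied to `z ∈ K(x, y)`. -/
def mobius (T : GL (Fin 2) K) (z : Rat2 K) : Rat2 K :=
  (algebraMap K (Rat2 K) (T 0 0) * z + algebraMap K (Rat2 K) (T 0 1)) /
    (algebraMap K (Rat2 K) (T 1 0) * z + algebraMap K (Rat2 K) (T 1 1))

/-- `r ∘ (T₁, T₂)`, that is `r(T₁(x), T₂(y))`. -/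
def compMobius (r : Rat2 K) (T₁ T₂ : GL (Fin 2) K) : Rat2 K :=
  evalAt (mobius T₁ (xvar K)) (mobius T₂ (yvar K)) r

open Classical in
/-- The point `s` of the curve associated with `p` is a pole of `r`: some transformation
`T = (T₁, T₂)` of `ℙ¹ × ℙ¹` maps `s` to `(∞, ∞)`, and the latter is a pole of `r ∘ T⁻¹` on the
curve associated with the numerator of `p ∘ T⁻¹`. -/
def IsPole (r : Rat2 K) (p : Poly K) (s : OnePoint K × OnePoint K) : Prop :=
  s ∈ curve p ∧ ∃ T₁ T₂ : GL (Fin 2) K,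
    T₁ • s.1 = OnePoint.infty ∧ T₂ • s.2 = OnePoint.infty ∧
    IsPoleAtInfty (compMobius r T₁⁻¹ T₂⁻¹)
      (numer (compMobius (algebraMap (Poly K) (Rat2 K) p) T₁⁻¹ T₂⁻¹))

/-! ### Orbits and their graphs -/

/-- Two points of the curve share a coordinate. -/
def ShareCoord {p : Poly K} (v w : curve p) : Prop := v.1.1 = w.1.1 ∨ v.1.2 = w.1.2

/-- The orbit of `s`: its class under the smallest equivalence relation on the curve that
relates any two points which share a coordinate. -/
def orbit (p : Poly K) (s : curve p) : Set (curve p) :=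
  {v | Relation.EqvGen ShareCoord s v}

/-- The graph of the orbit of `s`. -/
def orbitGraph (p : Poly K) (s : curve p) : SimpleGraph (orbit p s) where
  Adj v w := v ≠ w ∧ ShareCoord v.1 w.1
  symm := ⟨fun _ _ h => ⟨h.1.symm, h.2.imp Eq.symm Eq.symm⟩⟩
  loopless := ⟨fun _ h => h.1 rfl⟩

/-- An infinite path in a graph: consecutive vertices are adjacent. -/
def IsInfinitePath {V : Type*} (G : SimpleGraph V) (v : ℕ → V) : Prop :=
  ∀ i, G.Adj (v i) (v (i + 1))

/-- The path contains no cycle, a cycle being a part `v_i, …, v_j` with `i < j` and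
`v_i = v_j`. -/
def IsCycleFree {V : Type*} (v : ℕ → V) : Prop := ∀ i j, i < j → v i ≠ v j

/-- `v` is an infinite cycle-free path in the graph of the orbit of `s` that starts at `s` and
contains no pole of `r` other than `s`. -/
def IsAdmissiblePath (r : Rat2 K) (p : Poly K) (s : curve p) (v : ℕ → orbit p s) : Prop :=
  IsInfinitePath (orbitGraph p s) v ∧ IsCycleFree v ∧ (v 0).1 = s ∧
    ∀ i, IsPole r p (v i).1.1 → (v i).1 = s

end SepVar

end

/-! Suppose `(f, g)` lies in `F r p`. A branch of the curve through a point `s` is given by Puiseux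
data `(U, V)` with both coordinates transcendental over `K`. Such a point is generic: `p` divides
every polynomial vanishing there (`dvd_of_aeval_eq_zero`). Hence elements of `K[x, y]_p` are defined
at `(U, V)`, and `r(U, V) = f(U) - g(V)` (`hasValue_of_mem_F`).

Whether `f(U)` is infinite depends only on the first coordinate of `s`, which must lie in the finite
set `S` of poles of `f`; likewise for `g` and a finite set `T` of second coordinates. So a pole of
`r` has its first coordinate in `S` or its second in `T`. At any other point of the curve,
finiteness of `f(U) - g(V)` on one branch gives `s.1 ∈ S ↔ s.2 ∈ T`
(`exists_finite_poles_of_mem_F`). That every point carries a branch is `exists_puiseux_place`, a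
consequence of the Newton–Puiseux theorem `exists_puiseux_root`.

If `s.1 ∈ S`, the path whose first step keeps `s.1` carries this pole along: each later vertex
shares a coordinate with its predecessor and is not a pole of `r`, so it stays in `S ×ˢ T`. This is
impossible for infinitely many distinct vertices. If `s.2 ∈ T`, the other path gives the same
contradiction. -/

namespace SepVar
open Polynomial

/-! ### Weierstrass preparation -/

/-- A polynomial over a complete local ring whose reduction is nonzero is the product of a
distinguished polynomial and a polynomial whose constant coefficient is a unit. -/
theorem exists_eq_distinguished_mul {A : Type*} [CommRing A] [IsLocalRing A]
    [IsAdicComplete (IsLocalRing.maximalIdeal A) A] (q : A[X])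
    (hq : q.map (IsLocalRing.residue A) ≠ 0) :
    ∃ g h : A[X], q = g * h ∧ g.IsDistinguishedAt (IsLocalRing.maximalIdeal A) ∧
      IsUnit (h.coeff 0) := by
  have hq' : (q : PowerSeries A).map (IsLocalRing.residue A) ≠ 0 := by
    rw [← Polynomial.polynomial_map_coe]
    exact_mod_cast hq
  obtain ⟨f, H, hf⟩ := (q : PowerSeries A).exists_isWeierstrassFactorization hq'
  have hd := hf.isDistinguishedAt
  have hne : IsLocalRing.maximalIdeal A ≠ ⊤ := (IsLocalRing.maximalIdeal.isMaximal A).ne_top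
  have hnat : f.natDegree = ((f : PowerSeries A).map
      (Ideal.Quotient.mk (IsLocalRing.maximalIdeal A))).order.toNat := by
      have := hd.coe_natDegree_eq_order_map (f : PowerSeries A) 1
        (by rwa [PowerSeries.constantCoeff_one, ← Ideal.ne_top_iff_one]) (by simp)
      rw [← this, ENat.toNat_natCast]
  -- Weierstrass division by `f` is unique, and long division of polynomials is one instance of it.
  -- So the remainder is zero and the power series cofactor `H` is a polynomial.
  have key := (hd.isWeierstrassDivisorAt hne).eq_of_mul_add_eq_mul_add
    (q := H) (q' := (q /ₘ f : A[X])) (r := 0) (r' := q %ₘ f)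
    (by rw [degree_zero]; exact WithBot.bot_lt_coe _)
    (by
      rw [← hnat, ← degree_eq_natDegree hd.monic.ne_zero]
      exact degree_modByMonic_lt _ hd.monic)
    (by
      rw [← Polynomial.coe_mul, ← Polynomial.coe_add, add_comm (f * _), modByMonic_add_div,
        ← hf.eq_mul]
      simp)
  refine ⟨f, q /ₘ f, ?_, hd, ?_⟩
  · conv_lhs => rw [← modByMonic_add_div q f, ← key.2, zero_add]
  · have := PowerSeries.isUnit_iff_constantCoeff.1 hf.isUnit
    rwa [key.1, Polynomial.constantCoeff_coe] at this

section PowerSeriesField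

variable {K : Type*} [Field K]

instance isAdicComplete_powerSeries :
    IsAdicComplete (IsLocalRing.maximalIdeal (PowerSeries K)) (PowerSeries K) := by
  rw [PowerSeries.maximalIdeal_eq_span_X]
  infer_instance

/-- Weierstrass preparation for polynomials over `K⟦X⟧`. -/
theorem exists_eq_monic_mul (q : (PowerSeries K)[X])
    (hq : q.map (PowerSeries.constantCoeff (R := K)) ≠ 0) :
    ∃ g h : (PowerSeries K)[X], q = g * h ∧ g.Monic ∧
      g.map (PowerSeries.constantCoeff (R := K)) = X ^ g.natDegree ∧
      PowerSeries.constantCoeff (h.coeff 0) ≠ 0 := by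
  have hmem : ∀ a : PowerSeries K, a ∈ IsLocalRing.maximalIdeal (PowerSeries K) ↔
      PowerSeries.constantCoeff a = 0 := fun a => by
    rw [← PowerSeries.ker_coeff_eq_max_ideal, RingHom.mem_ker]
  obtain ⟨g, h, e, hd, hu⟩ := exists_eq_distinguished_mul q (by
    contrapose! hq
    ext i
    have := congr_arg (fun f => f.coeff i) hq
    simp only [coeff_map, coeff_zero, IsLocalRing.residue_eq_zero_iff, hmem] at this ⊢
    exact this)
  refine ⟨g, h, e, hd.monic, ?_, (PowerSeries.isUnit_iff_constantCoeff.1 hu).ne_zero⟩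
  ext i
  rw [coeff_map, coeff_X_pow]
  split_ifs with hi
  · rw [hi, hd.monic.coeff_natDegree, map_one]
  · rcases lt_or_gt_of_ne hi with hi | hi
    · exact (hmem _).1 (hd.mem hi)
    · rw [coeff_eq_zero_of_natDegree_lt hi, map_zero]

end PowerSeriesField

/-! ### The Newton–Puiseux theorem -/

theorem eval₂_taylor {R S : Type*} [CommRing R] [CommRing S] (f : R →+* S) (z : S) (r : R)
    (p : R[X]) : eval₂ f z (taylor r p) = eval₂ f (z + f r) p := by
  rw [taylor_apply, eval₂_comp]
  simp

/-- The Tschirnhaus transformation kills the second highest coefficient. -/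
theorem exists_coeff_taylor_eq_zero {R : Type*} [CommRing R] [Algebra ℚ R] (g : R[X])
    (hg : g.Monic) {d : ℕ} (hd : g.natDegree = d + 1) :
    ∃ r : R, (taylor r g).coeff d = 0 := by
  have h1 : algebraMap ℚ R ((d : ℚ) + 1)⁻¹ * ((d : R) + 1) = 1 := by
    have : ((d : R) + 1) = algebraMap ℚ R ((d : ℚ) + 1) := by simp
    rw [this, ← map_mul, inv_mul_cancel₀ (by positivity), map_one]
  -- Shifting by `r` turns the coefficient of index `d` into `g.coeff d + (d + 1) * r`.
  refine ⟨-(algebraMap ℚ R ((d : ℚ) + 1)⁻¹ * g.coeff d), ?_⟩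
  rw [taylor_coeff]
  have hdeg : (hasseDeriv d g).natDegree < 2 := by
    have := natDegree_hasseDeriv_le g d
    omega
  rw [eval_eq_sum_range' hdeg, Finset.sum_range_succ, Finset.sum_range_one, hasseDeriv_coeff,
    hasseDeriv_coeff]
  have : g.coeff (1 + d) = 1 := by rw [add_comm, ← hd]; exact hg
  rw [this]
  simp only [zero_add, Nat.choose_self, add_comm 1 d, Nat.choose_succ_self_right]
  push_cast
  linear_combination (-g.coeff d) * h1

/-- A monic polynomial whose coefficients are divisible by the appropriate powers of `s` is
obtained from a monic polynomial by scaling its roots by `s`. -/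
theorem exists_scaleRoots_eq {R : Type*} [CommRing R] [Nontrivial R] (f : R[X]) (hf : f.Monic)
    (s : R) (h : ∀ i < f.natDegree, s ^ (f.natDegree - i) ∣ f.coeff i) :
    ∃ g : R[X], g.Monic ∧ g.natDegree = f.natDegree ∧ scaleRoots g s = f := by
  choose! b hb using h
  set d := f.natDegree
  have hlt : (∑ i ∈ Finset.range d, monomial i (b i)).degree < (d : WithBot ℕ) := by
    refine (degree_sum_le _ _).trans_lt ((Finset.sup_lt_iff (WithBot.bot_lt_coe d)).2 ?_)
    intro i hi
    exact (degree_monomial_le i _).trans_lt (WithBot.coe_lt_coe.2 (Finset.mem_range.1 hi))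
  have hm : (X ^ d + ∑ i ∈ Finset.range d, monomial i (b i)).Monic := monic_X_pow_add hlt
  have hnd : (X ^ d + ∑ i ∈ Finset.range d, monomial i (b i)).natDegree = d :=
    natDegree_eq_of_degree_eq_some
      (by rw [degree_add_eq_left_of_degree_lt (by rwa [degree_X_pow]), degree_X_pow])
  refine ⟨_, hm, hnd, ?_⟩
  ext i
  rw [coeff_scaleRoots, hnd]
  rcases lt_trichotomy i d with hi | hi | hi
  · rw [hb i hi, coeff_add, coeff_X_pow, if_neg hi.ne, finsetSum_coeff]
    simp [coeff_monomial, hi, mul_comm]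
  · subst hi
    have := hm.coeff_natDegree
    rw [hnd] at this
    rw [this, tsub_self, pow_zero, mul_one]
    exact hf.coeff_natDegree.symm
  · rw [coeff_eq_zero_of_natDegree_lt (by rwa [hnd]), coeff_eq_zero_of_natDegree_lt hi, zero_mul]

section NewtonPuiseux

variable {K : Type*} [Field K]

variable (K) in
/-- The substitution `X ↦ X ^ n` in `K⟦X⟧`. -/
noncomputable def expandHom (n : ℕ) (hn : n ≠ 0) : PowerSeries K →+* PowerSeries K :=
  (PowerSeries.expand n hn).toRingHom

theorem expandHom_apply (n : ℕ) (hn : n ≠ 0) (a : PowerSeries K) :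
    expandHom K n hn a = PowerSeries.expand n hn a := rfl

/-- Rescaling a monic polynomial over `K⟦X⟧` along the lowest slope of its Newton polygon. -/
theorem exists_scaleRoots_eq_map_expand (g : (PowerSeries K)[X]) (hg : g.Monic)
    (h0 : ∃ i < g.natDegree, g.coeff i ≠ 0) :
    ∃ (n : ℕ) (hn : n ≠ 0) (k : ℕ) (f : (PowerSeries K)[X]), f.Monic ∧
      f.natDegree = g.natDegree ∧
      scaleRoots f (PowerSeries.X ^ k) = g.map (expandHom K n hn) ∧
      (∀ i, g.coeff i = 0 → f.coeff i = 0) ∧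
      ∃ i < g.natDegree, PowerSeries.constantCoeff (f.coeff i) ≠ 0 := by
  classical
  set d := g.natDegree with hd
  let o : ℕ → ℕ := fun i => (g.coeff i).order.toNat
  -- Take the lowest slope `o i / (d - i)`, ignoring zero coefficients, for which `o` is the default
  -- `0`. After `X ↦ X ^ (d - i₀)` the coefficient `i` has order `(d - i₀) * o i ≥ o i₀ * (d - i)`,
  -- with equality at `i₀`; hence the choices `n = d - i₀` and `k = o i₀`.
  obtain ⟨i₀, hi₀, hmin⟩ := Finset.exists_min_image
    ((Finset.range d).filter fun i => g.coeff i ≠ 0) (fun i => (o i : ℚ) / ((d - i : ℕ) : ℚ))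
    (by obtain ⟨i, hi, h⟩ := h0; exact ⟨i, by simp [hi, h]⟩)
  simp only [Finset.mem_filter, Finset.mem_range] at hi₀ hmin
  have hn : d - i₀ ≠ 0 := by omega
  have hle : ∀ i, i < d → g.coeff i ≠ 0 → o i₀ * (d - i) ≤ (d - i₀) * o i := by
    intro i hi hgi
    have h1 := hmin i ⟨hi, hgi⟩
    have p1 : (0 : ℚ) < ((d - i : ℕ) : ℚ) := by exact_mod_cast (by omega : 0 < d - i)
    have p2 : (0 : ℚ) < ((d - i₀ : ℕ) : ℚ) := by exact_mod_cast (by omega : 0 < d - i₀)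
    rw [div_le_div_iff₀ p2 p1] at h1
    rw [mul_comm (d - i₀)]
    exact_mod_cast h1
  set e : PowerSeries K →+* PowerSeries K := expandHom K (d - i₀) hn with he
  have hmd : (g.map e).natDegree = d := hg.natDegree_map e
  obtain ⟨f, hf, hfd, hfs⟩ := exists_scaleRoots_eq (g.map e) (hg.map e)
    (PowerSeries.X ^ o i₀ : PowerSeries K) (by
      rw [hmd]
      intro i hi
      rw [coeff_map]
      by_cases hgi : g.coeff i = 0
      · simp [hgi]
      · have h1 : (PowerSeries.X : PowerSeries K) ^ ((d - i₀) * o i) ∣ e (g.coeff i) := by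
          have := map_dvd e (PowerSeries.X_pow_order_dvd (φ := g.coeff i))
          rw [map_pow] at this
          rw [pow_mul]
          simpa [he, expandHom_apply] using this
        rw [← pow_mul]
        exact (pow_dvd_pow _ (hle i hi hgi)).trans h1)
  have hcoeff : ∀ i, f.coeff i * (PowerSeries.X ^ o i₀) ^ (d - i) = e (g.coeff i) := fun i => by
    rw [← coeff_map, ← hfs, coeff_scaleRoots, hfd, hmd]
  refine ⟨d - i₀, hn, o i₀, f, hf, hfd.trans hmd, hfs, fun i hi => ?_, i₀, hi₀.1, fun hc => ?_⟩
  · have := hcoeff i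
    rw [hi, map_zero] at this
    exact (mul_eq_zero.1 this).resolve_right
      (pow_ne_zero _ (pow_ne_zero _ PowerSeries.X_ne_zero))
  · have h1 : (PowerSeries.X : PowerSeries K) ^ (1 + (d - i₀) * o i₀) ∣ e (g.coeff i₀) := by
      rw [← hcoeff i₀, pow_add, pow_one, mul_comm (d - i₀), pow_mul]
      exact mul_dvd_mul (PowerSeries.X_dvd_iff.2 hc) dvd_rfl
    have h2 := PowerSeries.X_pow_dvd_iff.1 h1 ((d - i₀) * o i₀) (by omega)
    have h3 : PowerSeries.coeff ((d - i₀) * o i₀) (e (g.coeff i₀)) =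
        PowerSeries.coeff (o i₀) (g.coeff i₀) :=
      PowerSeries.coeff_expand_mul (d - i₀) hn (g.coeff i₀) (o i₀)
    rw [h3] at h2
    exact PowerSeries.coeff_order hi₀.2 h2

variable [IsAlgClosed K] [CharZero K]

/-- **Newton–Puiseux theorem**: a monic polynomial of positive degree over `K⟦X⟧` has a root in
`K⟦X ^ (1 / n)⟧` for some `n`. -/
theorem exists_puiseux_root (g : (PowerSeries K)[X]) (hg : g.Monic) (hd : g.natDegree ≠ 0) :
    ∃ (n : ℕ) (hn : n ≠ 0) (z : PowerSeries K),
      eval₂ (expandHom K n hn) z g = 0 := by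
  induction hD : g.natDegree using Nat.strong_induction_on generalizing g with
  | _ D IH =>
  obtain ⟨d, rfl⟩ : ∃ d, D = d + 1 := ⟨D - 1, by omega⟩
  let _ : Algebra ℚ K := DivisionRing.toRatAlgebra
  obtain ⟨r, hr⟩ := exists_coeff_taylor_eq_zero g hg hD
  suffices H : ∃ (n : ℕ) (hn : n ≠ 0) (z : PowerSeries K),
      eval₂ (expandHom K n hn) z (taylor r g) = 0 by
    obtain ⟨n, hn, z, hz⟩ := H
    exact ⟨n, hn, _, (eval₂_taylor _ _ _ _).symm.trans hz⟩
  have htm : (taylor r g).Monic := by rw [Monic, leadingCoeff_taylor]; exact hg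
  have htd : (taylor r g).natDegree = d + 1 := by rw [natDegree_taylor, hD]
  clear hd hD
  generalize taylor r g = t at hr htm htd
  clear hg g
  by_cases h0 : t.coeff 0 = 0
  · refine ⟨1, one_ne_zero, 0, ?_⟩
    rw [eval₂_at_zero, h0, map_zero]
  obtain ⟨N, hN, k, f, hf, hfd, hfs, hz, i₀, hi₀, hfi⟩ :=
    exists_scaleRoots_eq_map_expand t htm ⟨0, by omega, h0⟩
  rw [htd] at hfd hi₀
  set cc := PowerSeries.constantCoeff (R := K) with hcc
  have hmd : (f.map cc).natDegree = d + 1 := by rw [hf.natDegree_map, hfd]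
  obtain ⟨c, hc⟩ := IsAlgClosed.exists_root (f.map cc)
    (by rw [degree_eq_natDegree (hf.map cc).ne_zero, hmd]; exact_mod_cast (Nat.succ_ne_zero d))
  set q := taylor (PowerSeries.C c) f with hq
  have hqc : q.map cc = taylor c (f.map cc) := by
    rw [hq, map_taylor]
    simp [hcc]
  have hqm : q.Monic := by rw [Monic, hq, leadingCoeff_taylor]; exact hf
  have hqd : q.natDegree = d + 1 := by rw [hq, natDegree_taylor, hfd]
  obtain ⟨G, h, hGh, hG, hGr, hh⟩ := exists_eq_monic_mul q (hqm.map cc).ne_zero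
  have hhm : h.Monic := hG.of_mul_monic_left (hGh ▸ hqm)
  have hnd : G.natDegree + h.natDegree = d + 1 := by rw [← hqd, hGh, hG.natDegree_mul hhm]
  have hG0 : G.natDegree ≠ 0 := by
    intro h1
    have h2 : (q.map cc).coeff 0 = 0 := by rw [hqc, taylor_coeff_zero]; exact hc
    rw [hGh, Polynomial.map_mul, hGr, h1, pow_zero, one_mul, coeff_map] at h2
    exact hh h2
  -- This makes the degree drop. Otherwise the reduction of `f` is `(X - c) ^ (d + 1)`; its second
  -- highest coefficient vanishes by the Tschirnhaus shift, so `c = 0` in characteristic zero, and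
  -- no lower coefficient survives, contrary to the choice of `i₀`.
  have hh0 : h.natDegree ≠ 0 := by
    intro h1
    have h2 : h = 1 := hhm.natDegree_eq_zero.1 h1
    have h3 : taylor c (f.map cc) = X ^ (d + 1) := by
      rw [← hqc, hGh, h2, mul_one, hGr]
      congr 1
      omega
    have h4 : f.map cc = (X - C c) ^ (d + 1) := by
      apply taylor_injective c
      rw [h3, taylor_pow]
      simp
    have h5 : (f.map cc).nextCoeff = 0 := by
      rw [nextCoeff_of_natDegree_pos (by omega), hmd, Nat.add_sub_cancel, coeff_map, hz d hr,
        map_zero]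
    rw [h4, (monic_X_sub_C c).nextCoeff_pow, nextCoeff_X_sub_C, nsmul_eq_mul] at h5
    have h6 : c = 0 := by
      have : ((d + 1 : ℕ) : K) ≠ 0 := Nat.cast_ne_zero.2 (Nat.succ_ne_zero d)
      exact neg_eq_zero.1 ((mul_eq_zero.1 h5).resolve_left this)
    apply hfi
    have h7 : (f.map cc).coeff i₀ = 0 := by
      rw [h4, h6, C_0, sub_zero, coeff_X_pow, if_neg hi₀.ne]
    rwa [coeff_map] at h7
  obtain ⟨n, hn, z, hzG⟩ := IH G.natDegree (by omega) G hG hG0 rfl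
  set e : PowerSeries K →+* PowerSeries K := expandHom K n hn with he
  have hzq : eval₂ e z q = 0 := by rw [hGh, eval₂_mul, hzG, zero_mul]
  rw [hq, eval₂_taylor] at hzq
  have hs := scaleRoots_eval₂_eq_zero e (s := PowerSeries.X ^ k) hzq
  rw [hfs, eval₂_map] at hs
  -- Undo the shift by `c`, then the scaling by `X ^ k`; the substitutions `X ↦ X ^ N` and `X ↦ X ^
  -- n` compose.
  refine ⟨n * N, mul_ne_zero hn hN, e (PowerSeries.X ^ k) * (z + e (PowerSeries.C c)),
    Eq.trans ?_ hs⟩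
  congr 1
  ext1 a
  exact PowerSeries.expand_mul n hn N hN a

/-- A polynomial over `K⟦X⟧` with nonzero reduction, and whose reduction vanishes at `0`, has a root
without constant term in `K⟦X ^ (1 / n)⟧` for some `n`. -/
theorem exists_puiseux_root_constantCoeff_eq_zero (q : (PowerSeries K)[X])
    (hq : q.map (PowerSeries.constantCoeff (R := K)) ≠ 0)
    (hq0 : PowerSeries.constantCoeff (q.coeff 0) = 0) :
    ∃ (n : ℕ) (hn : n ≠ 0) (z : PowerSeries K), PowerSeries.constantCoeff z = 0 ∧
      eval₂ (expandHom K n hn) z q = 0 := by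
  obtain ⟨g, h, hgh, hg, hgr, hh⟩ := exists_eq_monic_mul q hq
  have hg0 : g.natDegree ≠ 0 := by
    intro h1
    rw [hg.natDegree_eq_zero.1 h1, one_mul] at hgh
    exact hh (hgh ▸ hq0)
  obtain ⟨n, hn, z, hz⟩ := exists_puiseux_root g hg hg0
  refine ⟨n, hn, z, ?_, by rw [hgh, eval₂_mul, hz, zero_mul]⟩
  -- Modulo `X`, the factor `g` is a pure power, so the constant term of its root is nilpotent.
  have h1 := congr_arg (PowerSeries.constantCoeff (R := K)) hz
  rw [hom_eval₂, map_zero] at h1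
  have h2 : (PowerSeries.constantCoeff (R := K)).comp
      (expandHom K n hn) = PowerSeries.constantCoeff := by
    ext1 a
    exact PowerSeries.constantCoeff_expand n hn a
  rw [h2, ← eval_map, hgr, eval_pow, eval_X] at h1
  exact pow_eq_zero_iff hg0 |>.1 h1

end NewtonPuiseux

end SepVar

/-! ### The valuation on series in `x⁻¹` and the embedding of power series -/

namespace SepVar

section Hahn

variable {K : Type*} [Field K]

variable (K) in
/-- The valuation of a series by the order in `x⁻¹`. -/
noncomputable def hahnVal : Valuation (HahnSeries ℚ K) (Multiplicative (WithTop ℚ)ᵒᵈ) :=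
  (HahnSeries.addVal ℚ K).toValuation

theorem hahnVal_le_one_iff (φ : HahnSeries ℚ K) : hahnVal K φ ≤ 1 ↔ 0 ≤ φ.orderTop := by
  rw [← HahnSeries.addVal_apply]
  exact Iff.rfl

theorem hahnVal_lt_one_iff (φ : HahnSeries ℚ K) : hahnVal K φ < 1 ↔ 0 < φ.orderTop := by
  rw [← HahnSeries.addVal_apply]
  exact Iff.rfl

/-- The valuation is multiplicative with reversed order, so values above `1` mean poles. The zero
series fails both sides. -/
theorem zero_lt_deg_iff (φ : HahnSeries ℚ K) : 0 < deg φ ↔ 1 < hahnVal K φ := by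
  rw [← not_le, ← not_le, not_iff_not, hahnVal_le_one_iff, deg]
  split_ifs with h
  · simp [h]
  · rw [HahnSeries.orderTop_of_ne_zero h, ← HahnSeries.order_of_ne h]
    rw [← WithBot.coe_zero, ← WithTop.coe_zero, WithBot.coe_le_coe, WithTop.coe_le_coe]
    simp

theorem algebraMap_hahnSeries (c : K) :
    algebraMap K (HahnSeries ℚ K) c = HahnSeries.single (0 : ℚ) c := by
  rw [HahnSeries.algebraMap_apply', PowerSeries.algebraMap_apply, Algebra.algebraMap_self_apply,
    HahnSeries.ofPowerSeries_C, HahnSeries.C_apply]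

theorem hahnVal_algebraMap_le_one (c : K) :
    hahnVal K (algebraMap K (HahnSeries ℚ K) c) ≤ 1 := by
  rw [hahnVal_le_one_iff]
  rw [algebraMap_hahnSeries]
  exact HahnSeries.orderTop_single_le

theorem one_lt_hahnVal_xSeries : 1 < hahnVal K (xSeries K) := by
  rw [← not_le, hahnVal_le_one_iff, xSeries, HahnSeries.orderTop_single one_ne_zero]
  decide

/-- The embedding `X ↦ x ^ (-1 / n)` of `K⟦X⟧` into the series in `x⁻¹`. -/
noncomputable def puiseuxHom (n : ℕ) (hn : n ≠ 0) : PowerSeries K →+* HahnSeries ℚ K :=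
  (HahnSeries.embDomainRingHom
    ((AddMonoidHom.mulRight ((n : ℚ)⁻¹)).comp (Nat.castAddMonoidHom ℚ))
    (fun i j h => by simpa [hn] using h)
    (fun i j => by
      have : (0 : ℚ) < (n : ℚ)⁻¹ := inv_pos.2 (by exact_mod_cast Nat.pos_of_ne_zero hn)
      simp [mul_le_mul_iff_left₀ this])).comp
  (HahnSeries.toPowerSeries (R := K)).symm.toRingHom

variable (n : ℕ) (hn : n ≠ 0)

theorem puiseuxHom_C (c : K) :
    puiseuxHom n hn (PowerSeries.C c) = algebraMap K (HahnSeries ℚ K) c := by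
  have : (HahnSeries.toPowerSeries (R := K)).symm (PowerSeries.C c) = HahnSeries.C c := by
    ext i
    simp [PowerSeries.coeff_C, HahnSeries.C_apply,
      HahnSeries.coeff_single]
  rw [puiseuxHom, RingHom.comp_apply, RingEquiv.toRingHom_eq_coe, RingEquiv.coe_toRingHom, this,
    algebraMap_hahnSeries]
  exact HahnSeries.embDomainRingHom_C

theorem puiseuxHom_X :
    puiseuxHom n hn (PowerSeries.X : PowerSeries K) = HahnSeries.single (n : ℚ)⁻¹ 1 := by
  have : (HahnSeries.toPowerSeries (R := K)).symm PowerSeries.X = HahnSeries.single 1 1 := by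
    ext i
    simp [PowerSeries.coeff_X, HahnSeries.coeff_single]
  rw [puiseuxHom, RingHom.comp_apply, RingEquiv.toRingHom_eq_coe, RingEquiv.coe_toRingHom, this]
  exact HahnSeries.embDomain_single.trans (by simp)

/-- The ramification `X ↦ X ^ n` cancels the exponent `1 / n`, so the local parameter of the base
becomes exactly `x⁻¹`. -/
theorem puiseuxHom_expandHom_X :
    puiseuxHom n hn (expandHom K n hn PowerSeries.X) = (xSeries K)⁻¹ := by
  rw [expandHom_apply, PowerSeries.expand_X, map_pow, puiseuxHom_X, xSeries,
    HahnSeries.single_pow, HahnSeries.inv_single]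
  simp [hn]

theorem support_puiseuxHom (a : PowerSeries K) :
    ∀ q ∈ (puiseuxHom n hn a).support, ∃ i : ℕ, PowerSeries.coeff i a ≠ 0 ∧ q = i / n := by
  intro q hq
  obtain ⟨i, hi, rfl⟩ := HahnSeries.support_embDomain_subset hq
  refine ⟨i, ?_, ?_⟩
  · simpa using hi
  · simp [div_eq_mul_inv]

theorem puiseuxHom_injective : Function.Injective (puiseuxHom (K := K) n hn) := by
  exact HahnSeries.embDomain_injective.comp (HahnSeries.toPowerSeries (R := K)).symm.injective

variable {n hn} in
theorem one_lt_hahnVal_inv_puiseuxHom {z : PowerSeries K} (hz : z ≠ 0)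
    (h : PowerSeries.constantCoeff z = 0) : 1 < hahnVal K (puiseuxHom n hn z)⁻¹ := by
  have hz' : puiseuxHom n hn z ≠ 0 := by
    rw [← map_zero (puiseuxHom n hn)]
    exact (puiseuxHom_injective n hn).ne hz
  have h1 : hahnVal K (puiseuxHom n hn z) < 1 := by
    rw [hahnVal_lt_one_iff, HahnSeries.orderTop_of_ne_zero hz', ← HahnSeries.order_of_ne hz',
      ← WithTop.coe_zero, WithTop.coe_lt_coe]
    obtain ⟨i, hi, hi'⟩ := support_puiseuxHom n hn z _ 
      (HahnSeries.coeff_order_eq_zero.not.2 hz')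
    rw [hi']
    have : i ≠ 0 := by
      rintro rfl
      rw [PowerSeries.coeff_zero_eq_constantCoeff_apply] at hi
      exact hi h
    positivity
  by_contra! h2
  have h3 := mul_lt_one_of_lt_of_le h1 h2
  rw [← map_mul, mul_inv_cancel₀ hz', map_one] at h3
  exact h3.false

/-- For `z ≠ 0` there is a unit `u` with `z * u = X ^ m`, so the inverse is `x ^ (m / n)` times the
image of `u`, and `n` is still a common denominator. -/
theorem isPuiseux_inv_puiseuxHom (z : PowerSeries K) : IsPuiseux (puiseuxHom n hn z)⁻¹ := by
  by_cases hz : z = 0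
  · exact ⟨1, one_pos, by simp [hz]⟩
  obtain ⟨m, u, hu⟩ := IsDiscreteValuationRing.associated_pow_irreducible hz
    (PowerSeries.X_irreducible (R := K))
  have h1 : (puiseuxHom n hn z)⁻¹ =
      HahnSeries.single (-((m : ℚ) * (n : ℚ)⁻¹)) 1 * puiseuxHom n hn u := by
    have hz' : puiseuxHom n hn z ≠ 0 := by
      rw [← map_zero (puiseuxHom n hn)]
      exact (puiseuxHom_injective n hn).ne hz
    have h2 : puiseuxHom n hn z * puiseuxHom n hn u =
        HahnSeries.single ((m : ℚ) * (n : ℚ)⁻¹) 1 := by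
      rw [← map_mul, hu, map_pow, puiseuxHom_X, HahnSeries.single_pow]
      simp
    rw [inv_eq_iff_eq_inv]
    refine eq_inv_of_mul_eq_one_left ?_
    rw [mul_left_comm, h2, HahnSeries.single_mul_single]
    simp
  refine ⟨n, Nat.pos_of_ne_zero hn, fun q hq => ?_⟩
  rw [h1] at hq
  obtain ⟨i, hi, j, hj, rfl⟩ := HahnSeries.support_mul_subset hq
  obtain rfl := HahnSeries.support_single_subset hi
  obtain ⟨k, -, rfl⟩ := support_puiseuxHom n hn _ _ hj
  refine ⟨k - m, ?_⟩
  push_cast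
  ring

end Hahn
end SepVar

/-! ### Values of rational functions at points over an extension field -/

namespace SepVar
open MvPolynomial

section Value

variable {K L : Type*} [Field K] [Field L] [Algebra K L] {u v : L}

/-- The rational function `ρ` has a denominator that does not vanish at `(u, v)`, and its value
at this point is `z`. -/
def HasValue (u v : L) (ρ : Rat2 K) (z : L) : Prop :=
  ∃ N D : Poly K, aeval ![u, v] D ≠ 0 ∧
    ρ = algebraMap (Poly K) (Rat2 K) N / algebraMap (Poly K) (Rat2 K) D ∧
    z = aeval ![u, v] N / aeval ![u, v] D

theorem algebraMap_ne_zero_of_aeval_ne_zero {D : Poly K} (h : aeval ![u, v] D ≠ 0) :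
    algebraMap (Poly K) (Rat2 K) D ≠ 0 := by
  have : D ≠ 0 := by
    rintro rfl
    exact h (map_zero _)
  simpa using this

theorem hasValue_algebraMap (N : Poly K) :
    HasValue u v (algebraMap (Poly K) (Rat2 K) N) (aeval ![u, v] N) :=
  ⟨N, 1, by simp, by simp, by simp⟩

theorem hasValue_const (c : K) : HasValue u v (algebraMap K (Rat2 K) c) (algebraMap K L c) := by
  have := hasValue_algebraMap (u := u) (v := v) (C c : Poly K)
  rwa [aeval_C, ← MvPolynomial.algebraMap_eq, ← IsScalarTower.algebraMap_apply] at this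

theorem HasValue.add {ρ σ : Rat2 K} {z w : L} (hρ : HasValue u v ρ z) (hσ : HasValue u v σ w) :
    HasValue u v (ρ + σ) (z + w) := by
  obtain ⟨N, D, hD, rfl, rfl⟩ := hρ
  obtain ⟨N', D', hD', rfl, rfl⟩ := hσ
  refine ⟨N * D' + D * N', D * D', by simp [hD, hD'], ?_, ?_⟩
  · rw [div_add_div _ _ (algebraMap_ne_zero_of_aeval_ne_zero hD)
      (algebraMap_ne_zero_of_aeval_ne_zero hD')]
    simp only [map_add, map_mul]
  · rw [div_add_div _ _ hD hD']
    simp only [map_add, map_mul]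

theorem HasValue.mul {ρ σ : Rat2 K} {z w : L} (hρ : HasValue u v ρ z) (hσ : HasValue u v σ w) :
    HasValue u v (ρ * σ) (z * w) := by
  obtain ⟨N, D, hD, rfl, rfl⟩ := hρ
  obtain ⟨N', D', hD', rfl, rfl⟩ := hσ
  refine ⟨N * N', D * D', by simp [hD, hD'], ?_, ?_⟩
  · rw [div_mul_div_comm]
    simp only [map_mul]
  · rw [div_mul_div_comm]
    simp only [map_mul]

theorem HasValue.inv {ρ : Rat2 K} {z : L} (hρ : HasValue u v ρ z) (hz : z ≠ 0) :
    HasValue u v ρ⁻¹ z⁻¹ := by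
  obtain ⟨N, D, hD, rfl, rfl⟩ := hρ
  exact ⟨D, N, fun h => hz (by rw [h, zero_div]), inv_div _ _, inv_div _ _⟩

theorem HasValue.div {ρ σ : Rat2 K} {z w : L} (hρ : HasValue u v ρ z) (hσ : HasValue u v σ w)
    (hw : w ≠ 0) : HasValue u v (ρ / σ) (z / w) := by
  rw [div_eq_mul_inv, div_eq_mul_inv]
  exact hρ.mul (hσ.inv hw)

theorem HasValue.sub {ρ σ : Rat2 K} {z w : L} (hρ : HasValue u v ρ z) (hσ : HasValue u v σ w) :
    HasValue u v (ρ - σ) (z - w) := by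
  have h := hρ.add ((hasValue_const (-1)).mul hσ)
  simpa [sub_eq_add_neg] using h

theorem numer_div_denom (ρ : Rat2 K) :
    algebraMap (Poly K) (Rat2 K) (numer ρ) / algebraMap (Poly K) (Rat2 K) (denom ρ) = ρ :=
  IsFractionRing.mk'_num_den' (Poly K) ρ

theorem denom_ne_zero (ρ : Rat2 K) : denom ρ ≠ 0 :=
  nonZeroDivisors.coe_ne_zero (IsFractionRing.den (Poly K) ρ)

/-- `evalAt` uses the reduced fraction, while calculations produce unreduced ones. By coprimality
the reduced denominator divides `D`, so it does not vanish either. -/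
theorem HasValue.denom_ne_zero {ρ : Rat2 K} {z : L} (h : HasValue u v ρ z) :
    aeval ![u, v] (denom ρ) ≠ 0 ∧ evalAt u v ρ = z := by
  obtain ⟨N, D, hD, hρ, rfl⟩ := h
  have e : N * denom ρ = numer ρ * D := by
    apply IsFractionRing.injective (Poly K) (Rat2 K)
    have hd : algebraMap (Poly K) (Rat2 K) (denom ρ) ≠ 0 := by
      simpa using SepVar.denom_ne_zero ρ
    rw [← numer_div_denom ρ, div_eq_div_iff hd (algebraMap_ne_zero_of_aeval_ne_zero hD)] at hρ
    rw [map_mul, map_mul]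
    exact hρ.symm
  have hdvd : denom ρ ∣ D :=
    (IsFractionRing.num_den_reduced (Poly K) ρ).symm.dvd_of_dvd_mul_left
      (e ▸ dvd_mul_left (denom ρ) N)
  have h0 : aeval ![u, v] (denom ρ) ≠ 0 := by
    obtain ⟨E, rfl⟩ := hdvd
    rw [map_mul] at hD
    exact left_ne_zero_of_mul hD
  refine ⟨h0, ?_⟩
  rw [evalAt, div_eq_div_iff h0 hD, ← map_mul, ← map_mul, e]

theorem hasValue_evalAt {ρ : Rat2 K} (h : aeval ![u, v] (denom ρ) ≠ 0) :
    HasValue u v ρ (evalAt u v ρ) :=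
  ⟨numer ρ, denom ρ, h, (numer_div_denom ρ).symm, rfl⟩

theorem HasValue.aeval {a b : Rat2 K} {x y : L} (ha : HasValue u v a x) (hb : HasValue u v b y)
    (P : Poly K) : HasValue u v (aeval ![a, b] P) (aeval ![x, y] P) := by
  induction P using MvPolynomial.induction_on with
  | C c => simpa only [aeval_C] using hasValue_const c
  | add P Q hP hQ => simpa only [map_add] using hP.add hQ
  | mul_X P i hP =>
    rw [map_mul, map_mul, aeval_X, aeval_X]
    refine hP.mul ?_
    fin_cases i
    · exact ha
    · exact hb

theorem HasValue.evalAt {a b : Rat2 K} {x y : L} (ha : HasValue u v a x) (hb : HasValue u v b y)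
    {ρ : Rat2 K} (h : MvPolynomial.aeval ![x, y] (denom ρ) ≠ 0) :
    HasValue u v (evalAt a b ρ) (SepVar.evalAt x y ρ) :=
  (ha.aeval hb _).div (ha.aeval hb _) h

theorem evalAt_algebraMap (P : Poly K) :
    evalAt u v (algebraMap (Poly K) (Rat2 K) P) = aeval ![u, v] P :=
  (hasValue_algebraMap P).denom_ne_zero.2

/-- Over a factorial ring, an irreducible polynomial of positive degree divides every polynomial
with which it shares a root in an extension field. -/
theorem dvd_of_eval₂_eq_zero {R : Type*} [CommRing R] [IsDomain R] [UniqueFactorizationMonoid R]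
    {P H : Polynomial R} (hP : Irreducible P) (hdeg : P.natDegree ≠ 0) (φ : R →+* L)
    (hφ : Function.Injective φ) {u : L} (h0 : P.eval₂ φ u = 0) (h1 : H.eval₂ φ u = 0) :
    P ∣ H := by
  let F := FractionRing R
  let ψ : F →+* L := IsFractionRing.lift hφ
  have hψ : ψ.comp (algebraMap R F) = φ := RingHom.ext (IsFractionRing.lift_algebraMap hφ)
  have hprim : P.IsPrimitive := hP.isPrimitive hdeg
  have hirr : Irreducible (P.map (algebraMap R F)) := by
    let _ : NormalizedGCDMonoid R := (inferInstance : Nonempty (NormalizedGCDMonoid R)).some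
    exact hprim.irreducible_iff_irreducible_map_fraction_map.1 hP
  have hroot : ∀ q : Polynomial R, q.eval₂ φ u = 0 →
      (q.map (algebraMap R F)).eval₂ ψ u = 0 := fun q hq => by
    rw [Polynomial.eval₂_map, hψ, hq]
  -- Over the fraction field, coprimality would give a Bézout identity that reads `0 = 1` at `u`.
  -- Gauss's lemma then brings the divisibility back to `R`.
  have hdvd : P.map (algebraMap R F) ∣ H.map (algebraMap R F) := by
    by_contra hnd
    obtain ⟨a, b, hab⟩ := (hirr.coprime_iff_not_dvd).2 hnd
    have := congr_arg (Polynomial.eval₂ ψ u) hab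
    rw [Polynomial.eval₂_add, Polynomial.eval₂_mul, Polynomial.eval₂_mul, hroot P h0, hroot H h1,
      Polynomial.eval₂_one, mul_zero, mul_zero, add_zero] at this
    exact zero_ne_one this
  let _ : NormalizedGCDMonoid R := (inferInstance : Nonempty (NormalizedGCDMonoid R)).some
  exact hprim.dvd_of_fraction_map_dvd_fraction_map hdvd

/-- An irreducible polynomial of positive degree in `x` that vanishes at a point whose second
coordinate is transcendental divides every polynomial that vanishes there. -/
theorem dvd_of_aeval_eq_zero {p : Poly K} (hp : Irreducible p) (hpx : p.degreeOf 0 ≠ 0)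
    (hv : Transcendental K v) (h0 : aeval ![u, v] p = 0) {h : Poly K}
    (hh : aeval ![u, v] h = 0) : p ∣ h := by
  -- View `p` as a polynomial in `x` over `K[y]`; transcendence of `v` makes `y ↦ v` injective on
  -- the coefficients.
  set e := finSuccEquiv K 1
  set φ : MvPolynomial (Fin 1) K →ₐ[K] L := MvPolynomial.aeval fun _ => v
  have hφ : Function.Injective φ :=
    (algebraicIndependent_unique_type_iff (x := fun _ : Fin 1 => v)).2 hv
  have hcomp : ∀ q : Poly K, MvPolynomial.aeval ![u, v] q = (e q).eval₂ (φ : _ →+* L) u := by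
    intro q
    induction q using MvPolynomial.induction_on with
    | C c =>
      have : e (C c) = Polynomial.C (C c) := e.commutes c
      rw [aeval_C, this, Polynomial.eval₂_C]
      exact (φ.commutes c).symm
    | add P Q hP hQ => rw [map_add, map_add, Polynomial.eval₂_add, hP, hQ]
    | mul_X P i hP =>
      rw [map_mul, map_mul, Polynomial.eval₂_mul, hP, aeval_X]
      congr 1
      fin_cases i
      · have : e (X 0) = Polynomial.X := finSuccEquiv_X_zero
        change u = (e (X 0)).eval₂ _ u
        rw [this, Polynomial.eval₂_X]
      · refine Eq.symm ?_
        have : e (X 1) = Polynomial.C (X 0) := finSuccEquiv_X_succ (j := 0)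
        change (e (X 1)).eval₂ _ u = v
        rw [this, Polynomial.eval₂_C]
        exact aeval_X _ _
  have hpe : Irreducible (e p) := (MulEquiv.irreducible_iff e).2 hp
  rw [← map_dvd_iff e]
  exact dvd_of_eval₂_eq_zero hpe (by rwa [natDegree_finSuccEquiv]) _ hφ ((hcomp p).symm.trans h0)
    ((hcomp h).symm.trans hh)

end Value
end SepVar

/-! ### Centers on the projective line and poles in one variable -/

namespace SepVar

section Center

variable {K L Γ : Type*} [Field K] [Field L] [Algebra K L] [LinearOrderedCommGroupWithZero Γ]

/-- The element `U` of a valued field is centered at the point `a` of the projective line. -/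
def IsCenter (ν : Valuation L Γ) (U : L) : OnePoint K → Prop
  | none => 1 < ν U
  | some c => ν (U - algebraMap K L c) < 1

variable {ν : Valuation L Γ} (hν : ∀ c : K, ν (algebraMap K L c) ≤ 1)
include hν

theorem valuation_algebraMap_eq_one {c : K} (hc : c ≠ 0) : ν (algebraMap K L c) = 1 := by
  refine le_antisymm (hν c) ?_
  by_contra! h
  have h1 := mul_lt_one_of_lt_of_le h (hν c⁻¹)
  rw [← map_mul, ← map_mul, mul_inv_cancel₀ hc, map_one, map_one] at h1
  exact h1.false

theorem valuation_aeval_le_one (A : Polynomial K) {w : L} (hw : ν w ≤ 1) :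
    ν (Polynomial.aeval w A) ≤ 1 := by
  induction A using Polynomial.induction_on with
  | C c => simpa using hν c
  | add P Q hP hQ =>
    rw [map_add]
    exact ν.map_add_le hP hQ
  | monomial n c _ =>
    rw [map_mul, map_mul, Polynomial.aeval_C, map_pow, map_pow, Polynomial.aeval_X]
    exact mul_le_one' (hν c) (pow_le_one' hw _)

theorem valuation_le_one_of_sub {c : K} {w : L} (hw : ν (w - algebraMap K L c) < 1) :
    ν w ≤ 1 := by
  rw [← sub_add_cancel w (algebraMap K L c)]
  exact ν.map_add_le hw.le (hν c)

theorem valuation_aeval_sub_lt_one (A : Polynomial K) {c : K} {w : L}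
    (hw : ν (w - algebraMap K L c) < 1) :
    ν (Polynomial.aeval w A - algebraMap K L (A.eval c)) < 1 := by
  obtain ⟨B, hB⟩ := Polynomial.X_sub_C_dvd_sub_C_eval (p := A) (a := c)
  have h1 := congr_arg (Polynomial.aeval w) hB
  simp only [map_sub, map_mul, Polynomial.aeval_C, Polynomial.aeval_X] at h1
  rw [h1, map_mul]
  exact mul_lt_one_of_lt_of_le hw
    (valuation_aeval_le_one hν B (valuation_le_one_of_sub hν hw))

theorem valuation_aeval_lt_one (A : Polynomial K) {c : K} {w : L}
    (hw : ν (w - algebraMap K L c) < 1) (hc : A.eval c = 0) : ν (Polynomial.aeval w A) < 1 := by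
  have := valuation_aeval_sub_lt_one hν A hw
  rwa [hc, map_zero, sub_zero] at this

theorem valuation_aeval_eq_one (A : Polynomial K) {c : K} {w : L}
    (hw : ν (w - algebraMap K L c) < 1) (hc : A.eval c ≠ 0) : ν (Polynomial.aeval w A) = 1 := by
  have h := valuation_aeval_sub_lt_one hν A hw
  have h1 := valuation_algebraMap_eq_one hν hc
  rw [← h1] at h ⊢
  exact ν.map_eq_of_sub_lt h

/-- `A(U)` is `U ^ deg A` times the reversed polynomial at `U⁻¹`. As `U⁻¹` is centered at `0`, where
the reversed polynomial is the leading coefficient of `A`, the second factor has value `1`. -/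
theorem valuation_aeval_eq_pow {A : Polynomial K} (hA : A ≠ 0) {U : L} (hU : 1 < ν U) :
    ν (Polynomial.aeval U A) = ν U ^ A.natDegree := by
  have h0 : U ≠ 0 := by
    rintro rfl
    simp at hU
  let _ := invertibleOfNonzero h0
  have h1 := Polynomial.eval₂_reverse_mul_pow (algebraMap K L) U A
  have h2 : ν (Polynomial.aeval U⁻¹ A.reverse) = 1 :=
    valuation_aeval_eq_one hν A.reverse (c := 0)
      (by rw [map_zero, sub_zero, map_inv₀]; exact inv_lt_one_of_one_lt₀ hU)
      (by rwa [← Polynomial.coeff_zero_eq_eval_zero, Polynomial.coeff_zero_reverse,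
        Polynomial.leadingCoeff_ne_zero])
  rw [invOf_eq_inv, ← Polynomial.aeval_def, ← Polynomial.aeval_def] at h1
  rw [← h1, map_mul, h2, one_mul, map_pow]

theorem aeval_ne_zero_of_one_lt {A : Polynomial K} (hA : A ≠ 0) {U : L} (hU : 1 < ν U) :
    Polynomial.aeval U A ≠ 0 := by
  rw [← ν.ne_zero_iff, valuation_aeval_eq_pow hν hA hU]
  exact pow_ne_zero _ (zero_lt_one.trans hU).ne'

theorem transcendental_of_one_lt {U : L} (hU : 1 < ν U) : Transcendental K U := by
  rw [transcendental_iff]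
  intro A hA
  by_contra h
  exact aeval_ne_zero_of_one_lt hν h hU hA

/-- The poles of a rational function in one variable form a finite set, and determine at which
places the function takes an infinite value. -/
theorem exists_finite_poles {A B : Polynomial K} (hAB : IsCoprime A B) (hB : B ≠ 0) :
    ∃ S : Set (OnePoint K), S.Finite ∧ ∀ (a : OnePoint K) (U : L), IsCenter ν U a →
      Polynomial.aeval U B ≠ 0 →
      (1 < ν (Polynomial.aeval U A / Polynomial.aeval U B) ↔ a ∈ S) := by
  -- For a reduced fraction, `∞` is a pole when the numerator has larger degree, and a finite pole
  -- is a root of `B`, which by coprimality is not a root of `A`. The condition `B(U) ≠ 0` matters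
  -- because `U` may equal its center.
  refine ⟨{a | a = OnePoint.infty ∧ B.natDegree < A.natDegree} ∪
    (fun c : K => (c : OnePoint K)) '' {c | B.eval c = 0}, ?_, ?_⟩
  · refine Set.Finite.union ((Set.finite_singleton OnePoint.infty).subset fun a h => h.1) ?_
    exact Set.Finite.image _ (Polynomial.finite_setOfPred_isRoot hB)
  · intro a U hU hBU
    induction a using OnePoint.rec with
    | infty =>
      have hU' : 1 < ν U := hU
      have : (OnePoint.infty : OnePoint K) ∉ (fun c : K => (c : OnePoint K)) ''
          {c | B.eval c = 0} := by
        rintro ⟨c, -, h⟩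
        exact OnePoint.coe_ne_infty c h
      simp only [Set.mem_union, this, or_false, Set.mem_ofPred_eq, true_and]
      by_cases hA : A = 0
      · simp [hA]
      rw [map_div₀, valuation_aeval_eq_pow hν hA hU', valuation_aeval_eq_pow hν hB hU',
        one_lt_div₀ (pow_pos (zero_lt_one.trans hU') _)]
      exact pow_lt_pow_iff_right₀ hU'
    | coe c =>
      have hU' : ν (U - algebraMap K L c) < 1 := hU
      have : (c : OnePoint K) ∈ {a : OnePoint K | a = OnePoint.infty ∧
          B.natDegree < A.natDegree} ∪ (fun c : K => (c : OnePoint K)) '' {c | B.eval c = 0} ↔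
          B.eval c = 0 := by
        simp
      rw [this, map_div₀, one_lt_div₀ (by rwa [Valuation.pos_iff])]
      by_cases hc : B.eval c = 0
      · have hAc : A.eval c ≠ 0 := by
          intro hAc
          obtain ⟨u, v, h⟩ := hAB
          have := congr_arg (Polynomial.eval c) h
          simp [hAc, hc] at this
        rw [valuation_aeval_eq_one hν A hU' hAc]
        simp only [hc, iff_true]
        exact valuation_aeval_lt_one hν B hU' hc
      · rw [valuation_aeval_eq_one hν B hU' hc]
        simp only [hc, iff_false, not_lt]
        exact valuation_aeval_le_one hν A (valuation_le_one_of_sub hν hU')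

/-- The fractional linear transformation `z ↦ (a z + b) / (c z + d)` applied to `z ∈ L`. -/
def fracLinear (T : GL (Fin 2) K) (z : L) : L :=
  (algebraMap K L (T 0 0) * z + algebraMap K L (T 0 1)) /
    (algebraMap K L (T 1 0) * z + algebraMap K L (T 1 1))

theorem valuation_linear_ge {a b : K} (h : a ≠ 0) {z : L} (hz : 1 < ν z) :
    ν (algebraMap K L a * z + algebraMap K L b) = ν z := by
  have h1 : ν (algebraMap K L a * z) = ν z := by
    rw [map_mul, valuation_algebraMap_eq_one hν h, one_mul]
  rw [← h1]
  refine ν.map_add_eq_of_lt_left ?_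
  rw [h1]
  exact (hν b).trans_lt hz

theorem fracLinear_denom_ne_zero (T : GL (Fin 2) K) {z : L} (hz : 1 < ν z) :
    algebraMap K L (T 1 0) * z + algebraMap K L (T 1 1) ≠ 0 := by
  by_cases h : T 1 0 = 0
  · have h1 : T 1 1 ≠ 0 := by
      intro h1
      have := T.det_ne_zero
      rw [Matrix.det_fin_two, h, h1] at this
      simp at this
    simpa [h] using h1
  · rw [← ν.ne_zero_iff, valuation_linear_ge hν h hz]
    exact (zero_lt_one.trans hz).ne'

/-- A place where `z` is infinite is a place where `T z` is centered at `T ∞`. -/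
theorem isCenter_fracLinear [DecidableEq K] (T : GL (Fin 2) K) {z : L} (hz : 1 < ν z) :
    IsCenter ν (fracLinear T z) (T • (OnePoint.infty : OnePoint K)) := by
  have hdet := T.det_ne_zero
  rw [Matrix.det_fin_two] at hdet
  have hd := fracLinear_denom_ne_zero hν T hz
  rw [OnePoint.smul_infty_eq_ite]
  split_ifs with h
  · have h1 : T 0 0 ≠ 0 := by
      intro h1
      simp [h, h1] at hdet
    have h2 : T 1 1 ≠ 0 := by
      intro h2
      simp [h, h2] at hdet
    change 1 < ν (fracLinear T z)
    rw [fracLinear, map_div₀, valuation_linear_ge hν h1 hz, h, map_zero, zero_mul, zero_add,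
      valuation_algebraMap_eq_one hν h2, div_one]
    exact hz
  · change ν (fracLinear T z - algebraMap K L (T 0 0 / T 1 0)) < 1
    have h1 : algebraMap K L (T 1 0) ≠ 0 := by simpa using h
    have e : fracLinear T z - algebraMap K L (T 0 0 / T 1 0) =
        algebraMap K L (T 0 1 - T 1 1 * (T 0 0 / T 1 0)) /
          (algebraMap K L (T 1 0) * z + algebraMap K L (T 1 1)) := by
      rw [fracLinear, eq_div_iff hd, sub_mul, div_mul_cancel₀ _ hd]
      simp only [map_sub, map_mul, map_div₀]
      field_simp
      ring
    rw [e, map_div₀, valuation_linear_ge hν h hz, div_lt_one₀ (zero_lt_one.trans hz)]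
    exact (hν _).trans_lt hz

end Center
end SepVar

/-! ### The bi-homogeneous equation and its fibers -/

namespace SepVar
open MvPolynomial

section BiForm

variable {K R : Type*} [Field K] [CommRing R] [Algebra K R]

/-- The bi-homogenization of `p`, evaluated at `z` in the variable `i` and at `w` in the
variable `j`. -/
noncomputable def biForm (i j : Fin 2) (p : Poly K) (z w : Fin 2 → R) : R :=
  ∑ m ∈ p.support, algebraMap K R (p.coeff m) *
    (z 0 ^ (p.degreeOf i - m i) * z 1 ^ m i) * (w 0 ^ (p.degreeOf j - m j) * w 1 ^ m j)

theorem biForm_comm (i j : Fin 2) (p : Poly K) (z w : Fin 2 → R) :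
    biForm i j p z w = biForm j i p w z :=
  Finset.sum_congr rfl fun _ _ => mul_right_comm _ _ _

theorem map_biForm {S : Type*} [CommRing S] [Algebra K S] (f : R →+* S)
    (hf : ∀ c : K, f (algebraMap K R c) = algebraMap K S c) (i j : Fin 2) (p : Poly K)
    (z w : Fin 2 → R) : f (biForm i j p z w) = biForm i j p (f ∘ z) (f ∘ w) := by
  simp only [biForm, map_sum, map_mul, map_pow, hf, Function.comp_apply]

theorem mem_curve_iff (p : Poly K) (s : OnePoint K × OnePoint K) :
    s ∈ curve p ↔ biForm 0 1 p (homCoords s.1) (homCoords s.2) = 0 := by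
  have : eval (fun i : Fin 2 × Fin 2 => if i.1 = 0 then homCoords s.1 i.2 else homCoords s.2 i.2)
      (biHomogenization p) = biForm 0 1 p (homCoords s.1) (homCoords s.2) := by
    simp [biHomogenization, biForm]
  rw [← this]
  rfl

theorem biForm_eq {L : Type*} [Field L] [Algebra K L] (p : Poly K) {z w : Fin 2 → L}
    (hz : z 0 ≠ 0) (hw : w 0 ≠ 0) :
    biForm 0 1 p z w =
      z 0 ^ p.degreeOf 0 * w 0 ^ p.degreeOf 1 * aeval ![z 1 / z 0, w 1 / w 0] p := by
  rw [aeval_def, eval₂_eq', Finset.mul_sum]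
  refine Finset.sum_congr rfl fun m hm => ?_
  have h0 := monomial_le_degreeOf 0 hm
  have h1 := monomial_le_degreeOf 1 hm
  rw [Fin.prod_univ_two, pow_sub₀ _ hz h0, pow_sub₀ _ hw h1]
  simp only [Matrix.cons_val_zero, Matrix.cons_val_one, div_pow]
  field_simp

/-- Modulo `X i - C c` every polynomial is congruent to its specialization at `X i = c`. -/
theorem X_sub_C_dvd (i : Fin 2) (c : K) (p : Poly K)
    (h : aeval (fun k => if k = i then Polynomial.C c else Polynomial.X) p = (0 : Polynomial K)) :
    X i - C c ∣ p := by
  obtain ⟨j, hj⟩ : ∃ j : Fin 2, j ≠ i := exists_ne i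
  have key : ∀ q : Poly K, X i - C c ∣ q - Polynomial.aeval (X j : Poly K)
      (aeval (fun k => if k = i then Polynomial.C c else Polynomial.X) q : Polynomial K) := by
    intro q
    induction q using MvPolynomial.induction_on with
    | C a => simp [MvPolynomial.algebraMap_eq]
    | add P Q hP hQ =>
      rw [map_add, map_add, add_sub_add_comm]
      exact dvd_add hP hQ
    | mul_X P k hP =>
      rw [map_mul, map_mul, aeval_X]
      by_cases hk : k = i
      · subst hk
        rw [if_pos rfl, Polynomial.aeval_C, MvPolynomial.algebraMap_eq]
        have := dvd_add (hP.mul_right (C c)) (Dvd.intro_left P (rfl : P * (X k - C c) = _))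
        convert this using 1
        ring
      · rw [if_neg hk, Polynomial.aeval_X, (by omega : j = k), ← sub_mul]
        exact ((by omega : j = k) ▸ hP).mul_right _
  have := key p
  rwa [h, map_zero, sub_zero] at this

/-- The specialization of the bi-homogenization at a point of the projective line in one of
the variables. -/
noncomputable def specialize (i j : Fin 2) (p : Poly K) (a : OnePoint K) : Polynomial K :=
  ∑ m ∈ p.support, Polynomial.monomial (m j)
    (p.coeff m * (homCoords a 0 ^ (p.degreeOf i - m i) * homCoords a 1 ^ m i))

/-- The curve contains no whole fiber. At `∞` a monomial of maximal degree in the variable `i`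
survives. At a finite `c`, vanishing would make `X i - C c` a factor of the irreducible `p`, which
would then not involve the variable `j`. -/
theorem specialize_ne_zero {i j : Fin 2} (hij : i ≠ j) {p : Poly K} (hp : Irreducible p)
    (hdeg : p.degreeOf j ≠ 0) (a : OnePoint K) : specialize i j p a ≠ 0 := by
  intro h
  induction a using OnePoint.rec with
  | infty =>
    obtain ⟨m, hm, hmi⟩ := Finset.exists_mem_eq_sup p.support
      (support_nonempty.2 hp.ne_zero) (fun m => m i)
    rw [← degreeOf_eq_sup] at hmi
    have h1 := congr_arg (fun q => q.coeff (m j)) h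
    simp only [specialize, Polynomial.finsetSum_coeff, Polynomial.coeff_monomial,
      Polynomial.coeff_zero] at h1
    rw [Finset.sum_eq_single_of_mem m hm] at h1
    · have : homCoords (OnePoint.infty : OnePoint K) 1 = 1 := rfl
      rw [if_pos rfl, hmi, tsub_self, this] at h1
      simp at h1
      exact (mem_support_iff.1 hm) h1
    · intro m' hm' hne
      split_ifs with h2
      · have h3 : m' i ≠ m i := by
          intro h3
          apply hne
          ext k
          rcases (by omega : k = i ∨ k = j) with rfl | rfl
          · exact h3
          · exact h2
        have h4 := monomial_le_degreeOf i hm'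
        have : homCoords (OnePoint.infty : OnePoint K) 0 = 0 := rfl
        rw [this, zero_pow (by omega), zero_mul, mul_zero]
      · rfl
  | coe c =>
    have h1 : aeval (fun k => if k = i then Polynomial.C c else Polynomial.X) p =
        specialize i j p (c : OnePoint K) := by
      rw [aeval_def, eval₂_eq']
      refine Finset.sum_congr rfl fun m hm => ?_
      have e0 : homCoords (c : OnePoint K) 0 = 1 := rfl
      have e1 : homCoords (c : OnePoint K) 1 = c := rfl
      have h2 : ∏ k, (if k = i then Polynomial.C c else Polynomial.X : Polynomial K) ^ m k =
          Polynomial.C c ^ m i * Polynomial.X ^ m j := by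
        rw [Fin.prod_univ_two]
        rcases (by omega : (i = 0 ∧ j = 1) ∨ (i = 1 ∧ j = 0)) with ⟨rfl, rfl⟩ | ⟨rfl, rfl⟩
        · simp
        · simp [mul_comm]
      rw [h2, e0, e1, one_pow, one_mul, ← Polynomial.C_mul_X_pow_eq_monomial, Polynomial.C_mul,
        Polynomial.C_pow, mul_assoc]
      rfl
    obtain ⟨q, hq⟩ := X_sub_C_dvd i c p (h1.trans h)
    have hX : (X i + C (-c) : Poly K).degreeOf j = 0 := by
      have := degreeOf_add_le j (X i) (C (-c) : Poly K)
      rwa [degreeOf_X_of_ne hij.symm, degreeOf_C, max_self, Nat.le_zero] at this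
    have hu : IsUnit q := by
      refine (hp.isUnit_or_isUnit hq).resolve_left fun hu => ?_
      have := hu.map (eval fun _ => c)
      simp at this
    obtain ⟨u, -, rfl⟩ := isUnit_iff_eq_C_of_isReduced.1 hu
    apply hdeg
    rw [hq, ← Nat.le_zero, ← hX, sub_eq_add_neg, ← C_neg]
    exact degreeOf_mul_C_le _ _ _

theorem biForm_ne_zero {L : Type*} [Field L] [Algebra K L] {i j : Fin 2} (hij : i ≠ j)
    {p : Poly K} (hp : Irreducible p) (hdeg : p.degreeOf j ≠ 0) (a : OnePoint K)
    {w : Fin 2 → L} (hw : w 0 ≠ 0) (ht : Transcendental K (w 1 / w 0)) :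
    biForm i j p (algebraMap K L ∘ homCoords a) w ≠ 0 := by
  have h : biForm i j p (algebraMap K L ∘ homCoords a) w =
      w 0 ^ p.degreeOf j * Polynomial.aeval (w 1 / w 0) (specialize i j p a) := by
    rw [specialize, map_sum, Finset.mul_sum]
    refine Finset.sum_congr rfl fun m hm => ?_
    have h1 := monomial_le_degreeOf j hm
    rw [Polynomial.aeval_monomial, pow_sub₀ _ hw h1]
    simp only [Function.comp_apply, map_mul, map_pow, div_pow]
    field_simp
  rw [h]
  exact mul_ne_zero (pow_ne_zero _ hw)
    fun h0 => specialize_ne_zero hij hp hdeg a (transcendental_iff.1 ht _ h0)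

end BiForm

/-! ### Branches through the points of the curve -/

section Place

variable {K : Type*} [Field K]

/-- Homogeneous coordinates of a point near `a`, with local parameter `τ`. -/
def nearCoords {R : Type*} [CommRing R] [Algebra K R] (τ : R) : OnePoint K → Fin 2 → R
  | none => ![τ, 1]
  | some c => ![1, algebraMap K R c + τ]

theorem map_nearCoords {R S : Type*} [CommRing R] [Algebra K R] [CommRing S] [Algebra K S]
    (f : R →+* S) (hf : ∀ c : K, f (algebraMap K R c) = algebraMap K S c) (τ : R)
    (a : OnePoint K) : f ∘ nearCoords τ a = nearCoords (f τ) a := by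
  induction a using OnePoint.rec with
  | infty =>
    funext k
    fin_cases k
    · rfl
    · exact map_one f
  | coe c =>
    funext k
    fin_cases k
    · exact map_one f
    · exact (map_add f _ _).trans (congr_arg (· + f τ) (hf c))

theorem nearCoords_zero {R : Type*} [CommRing R] [Algebra K R] (a : OnePoint K) :
    nearCoords (0 : R) a = algebraMap K R ∘ homCoords a := by
  induction a using OnePoint.rec with
  | infty =>
    funext k
    fin_cases k
    · exact (map_zero _).symm
    · exact (map_one _).symm
  | coe c =>
    funext k
    fin_cases k
    · exact (map_one _).symm
    · exact add_zero _

/-- A fractional linear transformation that maps `∞` to `a`. -/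
noncomputable def fromInfty : OnePoint K → GL (Fin 2) K
  | none => 1
  | some c => Matrix.GeneralLinearGroup.mkOfDetNeZero !![c, 1; 1, 0] (by simp)

theorem fromInfty_smul [DecidableEq K] (a : OnePoint K) :
    fromInfty a • (OnePoint.infty : OnePoint K) = a := by
  induction a using OnePoint.rec with
  | infty => exact one_smul _ _
  | coe c =>
    rw [OnePoint.smul_infty_eq_ite]
    have h0 : (fromInfty (c : OnePoint K)) 0 0 = c := rfl
    have h1 : (fromInfty (c : OnePoint K)) 1 0 = 1 := rfl
    rw [h0, h1, if_neg one_ne_zero, div_one]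

/-- Matches two descriptions of a branch at `a`: a local parameter `z⁻¹`, and an infinite `z` moved
to `a` by `fromInfty a`, which is `z ↦ c + 1 / z` at a finite point `c`. -/
theorem nearCoords_inv {L : Type*} [Field L] [Algebra K L] {z : L} (hz : z ≠ 0)
    (a : OnePoint K) : nearCoords z⁻¹ a 0 ≠ 0 ∧
      nearCoords z⁻¹ a 1 / nearCoords z⁻¹ a 0 = fracLinear (fromInfty a) z := by
  induction a using OnePoint.rec with
  | infty =>
    refine ⟨inv_ne_zero hz, ?_⟩
    have h0 : nearCoords z⁻¹ (OnePoint.infty : OnePoint K) 0 = z⁻¹ := rfl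
    have h1 : nearCoords z⁻¹ (OnePoint.infty : OnePoint K) 1 = 1 := rfl
    have h2 : fromInfty (OnePoint.infty : OnePoint K) = 1 := rfl
    simp [h0, h1, h2, fracLinear]
  | coe c =>
    have h0 : nearCoords z⁻¹ (c : OnePoint K) 0 = 1 := rfl
    have h1 : nearCoords z⁻¹ (c : OnePoint K) 1 = algebraMap K L c + z⁻¹ := rfl
    have h00 : (fromInfty (c : OnePoint K)) 0 0 = c := rfl
    have h01 : (fromInfty (c : OnePoint K)) 0 1 = 1 := rfl
    have h10 : (fromInfty (c : OnePoint K)) 1 0 = 1 := rfl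
    have h11 : (fromInfty (c : OnePoint K)) 1 1 = 0 := rfl
    refine ⟨by rw [h0]; exact one_ne_zero, ?_⟩
    rw [h0, h1, fracLinear, h00, h01, h10, h11]
    simp only [map_one, map_zero, one_mul, add_zero, div_one]
    field_simp

/-- As `T` is invertible, `z` is a fractional linear expression in `T z`, so algebraicity of `T z`
would pass to `z`. -/
theorem transcendental_fracLinear {L : Type*} [Field L] [Algebra K L] (T : GL (Fin 2) K) {z : L}
    (hz : Transcendental K z) (hd : algebraMap K L (T 1 0) * z + algebraMap K L (T 1 1) ≠ 0) :
    Transcendental K (fracLinear T z) := by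
  intro hw
  apply hz
  set w := fracLinear T z with hwdef
  have hdet := T.det_ne_zero
  rw [Matrix.det_fin_two] at hdet
  have hdet' : algebraMap K L (T 0 0) * algebraMap K L (T 1 1) -
      algebraMap K L (T 0 1) * algebraMap K L (T 1 0) ≠ 0 := by
    rw [← map_mul, ← map_mul, ← map_sub]
    exact (map_ne_zero (algebraMap K L)).2 hdet
  have e : w * (algebraMap K L (T 1 0) * z + algebraMap K L (T 1 1)) =
      algebraMap K L (T 0 0) * z + algebraMap K L (T 0 1) := by
    rw [hwdef, fracLinear, div_mul_cancel₀ _ hd]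
  have h0 : algebraMap K L (T 1 0) * w - algebraMap K L (T 0 0) ≠ 0 := by
    intro h0
    apply hdet'
    have h1 : algebraMap K L (T 1 1) * w = algebraMap K L (T 0 1) := by
      linear_combination e - z * h0
    linear_combination (-algebraMap K L (T 1 1)) * h0 + algebraMap K L (T 1 0) * h1
  have h1 : z = (algebraMap K L (T 0 1) - algebraMap K L (T 1 1) * w) /
      (algebraMap K L (T 1 0) * w - algebraMap K L (T 0 0)) := by
    rw [eq_div_iff h0]
    linear_combination e
  rw [h1, div_eq_mul_inv]
  have ha : ∀ c : K, IsAlgebraic K (algebraMap K L c) := fun c => isAlgebraic_algebraMap c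
  exact ((ha _).sub ((ha _).mul hw)).mul (((ha _).mul hw).sub (ha _)).inv

theorem transcendental_fracLinear_of_one_lt (T : GL (Fin 2) K) {z : HahnSeries ℚ K}
    (hz : 1 < hahnVal K z) : Transcendental K (fracLinear T z) :=
  transcendental_fracLinear T (transcendental_of_one_lt hahnVal_algebraMap_le_one hz)
    (fracLinear_denom_ne_zero hahnVal_algebraMap_le_one T hz)

theorem biForm_nearCoords_ne_zero {i j : Fin 2} (hij : i ≠ j) {p : Poly K} (hp : Irreducible p)
    (hdeg : p.degreeOf j ≠ 0) (a b : OnePoint K) :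
    biForm i j p (algebraMap K (HahnSeries ℚ K) ∘ homCoords a) (nearCoords (xSeries K)⁻¹ b) ≠
      0 := by
  have ht : xSeries K ≠ 0 := by simp [xSeries]
  obtain ⟨h0, h1⟩ := nearCoords_inv (L := HahnSeries ℚ K) ht b
  refine biForm_ne_zero hij hp hdeg a h0 ?_
  rw [h1]
  exact transcendental_fracLinear_of_one_lt _ one_lt_hahnVal_xSeries

variable [IsAlgClosed K] [CharZero K]

/-- Through every point of the curve there is a place given by a Puiseux series. -/
theorem exists_puiseux_place {p : Poly K} (hp : Irreducible p) (hpx : p.degreeOf 0 ≠ 0)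
    (hpy : p.degreeOf 1 ≠ 0) {s : OnePoint K × OnePoint K} (hs : s ∈ curve p) :
    ∃ φ : HahnSeries ℚ K, IsPuiseux φ ∧ 1 < hahnVal K φ ∧
      aeval ![fracLinear (fromInfty s.1) (xSeries K), fracLinear (fromInfty s.2) φ] p = 0 := by
  set cc := PowerSeries.constantCoeff (R := K) with hcc
  -- The local equation at `s`: the power series variable is the parameter at `s.1`, the polynomial
  -- variable the one at `s.2`.
  let Q : Polynomial (PowerSeries K) := biForm 0 1 p
    (nearCoords (Polynomial.C PowerSeries.X) s.1) (nearCoords Polynomial.X s.2)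
  have halg : ∀ c : K, algebraMap K (Polynomial (PowerSeries K)) c =
      Polynomial.C (PowerSeries.C c) := fun c => rfl
  have hmap : ∀ {S : Type _} [CommRing S] [Algebra K S] (f : Polynomial (PowerSeries K) →+* S)
      (hf : ∀ c : K, f (algebraMap K _ c) = algebraMap K S c), f Q = biForm 0 1 p
        (nearCoords (f (Polynomial.C PowerSeries.X)) s.1) (nearCoords (f Polynomial.X) s.2) := by
    intro S _ _ f hf
    rw [map_biForm f hf, map_nearCoords f hf, map_nearCoords f hf]
  -- The reduction is the equation of the fiber over `s.1`; it is tested at a transcendental point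
  -- near `s.2`.
  have hQ1 : Q.map cc ≠ 0 := by
    intro h
    let f : Polynomial (PowerSeries K) →+* HahnSeries ℚ K :=
      (Polynomial.aeval (xSeries K)⁻¹ : Polynomial K →ₐ[K] HahnSeries ℚ K).toRingHom.comp
        (Polynomial.mapRingHom cc)
    have hf : f Q = 0 := by
      change Polynomial.aeval (xSeries K)⁻¹ (Q.map cc) = 0
      rw [h, map_zero]
    rw [hmap f (fun c => by simp [f, halg, hcc])] at hf
    have h1 : f (Polynomial.C PowerSeries.X) = 0 := by simp [f, hcc]
    have h2 : f Polynomial.X = (xSeries K)⁻¹ := by simp [f]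
    rw [h1, h2, nearCoords_zero] at hf
    exact biForm_nearCoords_ne_zero zero_ne_one hp hpy _ _ hf
  have hQ0 : cc (Q.coeff 0) = 0 := by
    let f : Polynomial (PowerSeries K) →+* K := cc.comp Polynomial.constantCoeff
    change f Q = 0
    rw [hmap f (fun c => by simp [f, halg, hcc])]
    have h1 : f (Polynomial.C PowerSeries.X) = 0 := by simp [f, hcc]
    have h2 : f Polynomial.X = 0 := by simp [f]
    rw [h1, h2, nearCoords_zero, nearCoords_zero]
    exact (mem_curve_iff p s).1 hs
  obtain ⟨n, hn, z, hz0, hz⟩ := exists_puiseux_root_constantCoeff_eq_zero Q hQ1 hQ0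
  let f : Polynomial (PowerSeries K) →+* HahnSeries ℚ K :=
    (puiseuxHom n hn).comp (Polynomial.eval₂RingHom (expandHom K n hn) z)
  have hf : f Q = 0 := by
    change puiseuxHom n hn (Q.eval₂ (expandHom K n hn) z) = 0
    rw [hz, map_zero]
  have h1 : f (Polynomial.C PowerSeries.X) = (xSeries K)⁻¹ := by
    simp [f, puiseuxHom_expandHom_X]
  have h2 : f Polynomial.X = puiseuxHom n hn z := by simp [f]
  rw [hmap f (fun c => by
    simp [f, halg, expandHom_apply, PowerSeries.expand_C, puiseuxHom_C]), h1, h2] at hf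
  -- If `z = 0`, the fiber with second coordinate `s.2` would lie in the curve. Nonvanishing allows
  -- `φ` to be the inverse of the image of `z`.
  have hzne : z ≠ 0 := by
    rintro rfl
    rw [map_zero, nearCoords_zero, biForm_comm] at hf
    exact biForm_nearCoords_ne_zero one_ne_zero hp hpx _ _ hf
  have hφ := one_lt_hahnVal_inv_puiseuxHom (n := n) (hn := hn) hzne hz0
  refine ⟨(puiseuxHom n hn z)⁻¹, isPuiseux_inv_puiseuxHom n hn z, hφ, ?_⟩
  have hφ0 : (puiseuxHom n hn z)⁻¹ ≠ 0 := by
    rw [← (hahnVal K).ne_zero_iff]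
    exact (zero_lt_one.trans hφ).ne'
  have hx := nearCoords_inv (K := K) (L := HahnSeries ℚ K) (z := xSeries K)
    (by simp [xSeries]) s.1
  have hy := nearCoords_inv (K := K) hφ0 s.2
  rw [inv_inv] at hy
  rw [biForm_eq p hx.1 hy.1, hx.2, hy.2] at hf
  exact (mul_eq_zero.1 hf).resolve_left
    (mul_ne_zero (pow_ne_zero _ hx.1) (pow_ne_zero _ hy.1))

end Place

end SepVar

/-! ### Comparing the poles of `r`, `f` and `g` along branches -/

namespace SepVar
open MvPolynomial

section Transformation

variable {K L Γ : Type*} [Field K] [Field L] [Algebra K L] [LinearOrderedCommGroupWithZero Γ]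

theorem HasValue.mobius {u v : L} {ρ : Rat2 K} {z : L} (h : HasValue u v ρ z)
    (T : GL (Fin 2) K) (hd : algebraMap K L (T 1 0) * z + algebraMap K L (T 1 1) ≠ 0) :
    HasValue u v (mobius T ρ) (fracLinear T z) :=
  (((hasValue_const _).mul h).add (hasValue_const _)).div
    (((hasValue_const _).mul h).add (hasValue_const _)) hd

theorem hasValue_xvar (u v : L) : HasValue u v (xvar K) u := by
  simpa [xvar] using hasValue_algebraMap (u := u) (v := v) (X 0 : Poly K)

theorem hasValue_yvar (u v : L) : HasValue u v (yvar K) v := by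
  simpa [yvar] using hasValue_algebraMap (u := u) (v := v) (X 1 : Poly K)

variable {ν : Valuation L Γ} (hν : ∀ c : K, ν (algebraMap K L c) ≤ 1) {u v : L}
  (hu : 1 < ν u) (hv : 1 < ν v) (S₁ S₂ : GL (Fin 2) K)
include hν hu hv

theorem hasValue_compMobius {ρ : Rat2 K}
    (h : aeval ![fracLinear S₁ u, fracLinear S₂ v] (denom ρ) ≠ 0) :
    HasValue u v (compMobius ρ S₁ S₂) (evalAt (fracLinear S₁ u) (fracLinear S₂ v) ρ) :=
  ((hasValue_xvar u v).mobius S₁ (fracLinear_denom_ne_zero hν S₁ hu)).evalAt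
    ((hasValue_yvar u v).mobius S₂ (fracLinear_denom_ne_zero hν S₂ hv)) h

/-- Branches at `(∞, ∞)` of the transformed curve correspond to branches of the original one,
because no denominator vanishes at infinite `u` and `v`. -/
theorem aeval_numer_compMobius_eq_zero_iff (p : Poly K) :
    aeval ![u, v] (numer (compMobius (algebraMap (Poly K) (Rat2 K) p) S₁ S₂)) = 0 ↔
      aeval ![fracLinear S₁ u, fracLinear S₂ v] p = 0 := by
  obtain ⟨h0, h1⟩ := (hasValue_compMobius hν hu hv S₁ S₂
    (hasValue_algebraMap p).denom_ne_zero.1).denom_ne_zero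
  rw [evalAt_algebraMap] at h1
  rw [← h1, evalAt, div_eq_zero_iff, or_iff_left h0]

end Transformation

section Separated

variable {K : Type*} [Field K]

/-- The elements of `K(x)` as reduced fractions. -/
theorem exists_isCoprime_of_mem_adjoin {F : Type*} [Field F] [Algebra K F] {x f : F}
    (hf : f ∈ IntermediateField.adjoin K {x}) :
    ∃ A B : Polynomial K, IsCoprime A B ∧ B ≠ 0 ∧
      f = Polynomial.aeval x A / Polynomial.aeval x B := by
  classical
  obtain ⟨A, B, rfl⟩ := (IntermediateField.mem_adjoin_simple_iff K f).1 hf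
  by_cases hB : Polynomial.aeval x B = 0
  · exact ⟨0, 1, isCoprime_one_right, one_ne_zero, by simp [hB]⟩
  have hB0 : B ≠ 0 := by
    rintro rfl
    exact hB (map_zero _)
  obtain ⟨A', hA'⟩ := EuclideanDomain.gcd_dvd_left A B
  obtain ⟨B', hB'⟩ := EuclideanDomain.gcd_dvd_right A B
  set g := EuclideanDomain.gcd A B with hg
  have hg0 : g ≠ 0 := fun h => hB0 (by rw [hB', h, zero_mul])
  have hgx : Polynomial.aeval x g ≠ 0 := fun h => hB (by rw [hB', map_mul, h, zero_mul])
  refine ⟨A', B', ?_, fun h => hB0 (by rw [hB', h, mul_zero]), ?_⟩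
  · refine ⟨EuclideanDomain.gcdA A B, EuclideanDomain.gcdB A B, mul_left_cancel₀ hg0 ?_⟩
    have := EuclideanDomain.gcd_eq_gcd_ab A B
    rw [← hg] at this
    linear_combination -this - EuclideanDomain.gcdA A B * hA' - EuclideanDomain.gcdB A B * hB'
  · conv_lhs => rw [hA', hB', map_mul, map_mul, mul_div_mul_left _ _ hgx]

/-- A rational function in one of the variables is defined at every point at which this variable is
transcendental, and its poles there are determined by a finite set of centers. -/
theorem exists_finite_poles_of_mem_adjoin (i : Fin 2) {f : Rat2 K}
    (hf : f ∈ IntermediateField.adjoin K {algebraMap (Poly K) (Rat2 K) (X i)}) :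
    ∃ S : Set (OnePoint K), S.Finite ∧ ∀ (a : OnePoint K) (U V : HahnSeries ℚ K),
      Transcendental K ((![U, V] : Fin 2 → HahnSeries ℚ K) i) →
      IsCenter (hahnVal K) ((![U, V] : Fin 2 → HahnSeries ℚ K) i) a →
      ∃ z, HasValue U V f z ∧ (1 < hahnVal K z ↔ a ∈ S) := by
  obtain ⟨A, B, hAB, hB, rfl⟩ := exists_isCoprime_of_mem_adjoin hf
  obtain ⟨S, hS, h⟩ := exists_finite_poles (ν := hahnVal K) hahnVal_algebraMap_le_one hAB hB
  refine ⟨S, hS, fun a U V ht hc => ?_⟩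
  have hval : ∀ P : Polynomial K,
      HasValue U V (Polynomial.aeval (algebraMap (Poly K) (Rat2 K) (X i)) P)
        (Polynomial.aeval ((![U, V] : Fin 2 → HahnSeries ℚ K) i) P) := fun P => by
    have := hasValue_algebraMap (u := U) (v := V) (Polynomial.aeval (X i : Poly K) P)
    rwa [← Polynomial.aeval_algebraMap_apply, ← Polynomial.aeval_algHom_apply, aeval_X] at this
  have hB0 : Polynomial.aeval ((![U, V] : Fin 2 → HahnSeries ℚ K) i) B ≠ 0 :=
    fun h0 => hB (transcendental_iff.1 ht B h0)
  exact ⟨_, (hval A).div (hval B) hB0, h a _ hc hB0⟩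

theorem one_lt_of_one_lt_sub {L Γ : Type*} [Field L] [LinearOrderedCommGroupWithZero Γ]
    (ν : Valuation L Γ) {a b : L} (h : 1 < ν (a - b)) : 1 < ν a ∨ 1 < ν b := by
  by_contra! h1
  exact (h.trans_le (ν.map_sub_le h1.1 h1.2)).false

theorem one_lt_iff_of_sub_le_one {L Γ : Type*} [Field L] [LinearOrderedCommGroupWithZero Γ]
    (ν : Valuation L Γ) {a b : L} (h : ν (a - b) ≤ 1) : 1 < ν a ↔ 1 < ν b := by
  rw [← not_le, ← not_le, not_iff_not]
  constructor
  · intro ha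
    rw [← sub_sub_cancel a b]
    exact ν.map_sub_le ha h
  · intro hb
    rw [← sub_add_cancel a b]
    exact ν.map_add_le h hb

/-- If `f - g ∈ r + ⟨p⟩`, then `r` takes the value `f - g` at the generic points of the curve. -/
theorem hasValue_of_mem_F {p : Poly K} (hp : Irreducible p) (hpx : p.degreeOf 0 ≠ 0)
    {r : Rat2 K} {fg : Kx K × Ky K} (hfg : fg ∈ F r p) {L : Type*} [Field L] [Algebra K L]
    {U V z w : L} (hV : Transcendental K V) (h0 : aeval ![U, V] p = 0)
    (hz : HasValue U V (fg.1 : Rat2 K) z) (hw : HasValue U V (fg.2 : Rat2 K) w) :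
    HasValue U V r (z - w) := by
  obtain ⟨h, ⟨q, hq, rfl⟩, e⟩ := hfg
  -- By genericity, a denominator vanishing at `(U, V)` would be divisible by `p`, which membership
  -- in the local ring excludes.
  have hq' : aeval ![U, V] (denom q) ≠ 0 := fun h1 => hq (dvd_of_aeval_eq_zero hp hpx hV h0 h1)
  have e' : r = ((fg.1 : Rat2 K) - fg.2) - q * algebraMap (Poly K) (Rat2 K) p := by
    rw [e]
    ring
  have := (hz.sub hw).sub ((hasValue_evalAt hq').mul (hasValue_algebraMap p))
  rw [← e', h0, mul_zero, sub_zero] at this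
  exact this

variable [IsAlgClosed K] [CharZero K]

/-- The poles of `f` and `g` with `f - g ∈ r + ⟨p⟩`: at a pole of `r` one of `f` and `g` has a pole,
at the other points of the curve either both have a pole or none of them. -/
theorem exists_finite_poles_of_mem_F {p : Poly K} (hp : Irreducible p) (hpx : p.degreeOf 0 ≠ 0)
    (hpy : p.degreeOf 1 ≠ 0) {r : Rat2 K} {fg : Kx K × Ky K} (hfg : fg ∈ F r p) :
    ∃ S T : Set (OnePoint K), S.Finite ∧ T.Finite ∧
      (∀ s, IsPole r p s → s.1 ∈ S ∨ s.2 ∈ T) ∧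
      ∀ s ∈ curve p, ¬ IsPole r p s → (s.1 ∈ S ↔ s.2 ∈ T) := by
  classical
  obtain ⟨S, hS, hS'⟩ := exists_finite_poles_of_mem_adjoin 0 fg.1.2
  obtain ⟨T, hT, hT'⟩ := exists_finite_poles_of_mem_adjoin 1 fg.2.2
  -- On a branch at `(S₁ ∞, S₂ ∞)`, `r` is the difference of the values of `f` and `g`, whose poles
  -- are read off from the center.
  have key : ∀ (S₁ S₂ : GL (Fin 2) K) (φ : HahnSeries ℚ K), 1 < hahnVal K φ →
      aeval ![fracLinear S₁ (xSeries K), fracLinear S₂ φ] p = 0 →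
      ∃ z w, evalAt (xSeries K) φ (compMobius r S₁ S₂) = z - w ∧
        (1 < hahnVal K z ↔ S₁ • (OnePoint.infty : OnePoint K) ∈ S) ∧
        (1 < hahnVal K w ↔ S₂ • (OnePoint.infty : OnePoint K) ∈ T) := by
    intro S₁ S₂ φ hφ h0
    have hx := one_lt_hahnVal_xSeries (K := K)
    have hV := transcendental_fracLinear_of_one_lt S₂ hφ
    obtain ⟨z, hz, hz'⟩ := hS' _ (fracLinear S₁ (xSeries K)) (fracLinear S₂ φ)
      (transcendental_fracLinear_of_one_lt S₁ hx)
      (isCenter_fracLinear hahnVal_algebraMap_le_one S₁ hx)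
    obtain ⟨w, hw, hw'⟩ := hT' _ (fracLinear S₁ (xSeries K)) (fracLinear S₂ φ) hV
      (isCenter_fracLinear hahnVal_algebraMap_le_one S₂ hφ)
    obtain ⟨hd, hr⟩ := (hasValue_of_mem_F hp hpx hfg hV h0 hz hw).denom_ne_zero
    refine ⟨z, w, ?_, hz', hw'⟩
    rw [← hr]
    exact (hasValue_compMobius hahnVal_algebraMap_le_one hx hφ S₁ S₂ hd).denom_ne_zero.2
  refine ⟨S, T, hS, hT, ?_, ?_⟩
  · rintro s ⟨-, T₁, T₂, h1, h2, φ, -, h0, hφ, hr⟩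
    rw [zero_lt_deg_iff] at hφ hr
    rw [aeval_numer_compMobius_eq_zero_iff hahnVal_algebraMap_le_one one_lt_hahnVal_xSeries hφ]
      at h0
    obtain ⟨z, w, e, hz, hw⟩ := key _ _ φ hφ h0
    rw [← h1, inv_smul_smul] at hz
    rw [← h2, inv_smul_smul] at hw
    rw [e] at hr
    rw [← hz, ← hw]
    exact one_lt_of_one_lt_sub _ hr
  · intro s hs hpole
    obtain ⟨φ, hφp, hφ, h0⟩ := exists_puiseux_place hp hpx hpy hs
    obtain ⟨z, w, e, hz, hw⟩ := key _ _ φ hφ h0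
    rw [fromInfty_smul] at hz hw
    rw [← hz, ← hw]
    -- One branch suffices: if `f - g` were infinite on it, this branch would itself witness that
    -- `s` is a pole of `r`.
    refine one_lt_iff_of_sub_le_one _ ?_
    by_contra! hr
    rw [← e, ← zero_lt_deg_iff] at hr
    refine hpole ⟨hs, (fromInfty s.1)⁻¹, (fromInfty s.2)⁻¹, ?_, ?_, ?_⟩
    · rw [inv_smul_eq_iff, fromInfty_smul]
    · rw [inv_smul_eq_iff, fromInfty_smul]
    · rw [inv_inv, inv_inv]
      refine ⟨φ, hφp, ?_, (zero_lt_deg_iff φ).2 hφ, hr⟩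
      rwa [aeval_numer_compMobius_eq_zero_iff hahnVal_algebraMap_le_one
        one_lt_hahnVal_xSeries hφ]

end Separated

/-! ### Propagation along paths -/

/-- An infinite cycle-free path cannot stay in the product of two finite sets, hence it cannot
propagate a common pole of `f` and `g`. -/
theorem IsAdmissiblePath.false_of_finite {K : Type*} [Field K] {p : Poly K} {r : Rat2 K}
    {s : curve p} {v : ℕ → orbit p s} (hv : IsAdmissiblePath r p s v)
    {S T : Set (OnePoint K)} (hS : S.Finite) (hT : T.Finite)
    (hST : ∀ s ∈ curve p, ¬ IsPole r p s → (s.1 ∈ S ↔ s.2 ∈ T))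
    (h1 : (v 1).1.1.1 ∈ S ∨ (v 1).1.1.2 ∈ T) : False := by
  obtain ⟨hpath, hcyc, h0, hpole⟩ := hv
  -- The only pole allowed on the path is `s = v 0`, and cycle-freeness prevents a return to it;
  -- hence the indices start at `1`.
  have hiff : ∀ i, (v (i + 1)).1.1.1 ∈ S ↔ (v (i + 1)).1.1.2 ∈ T := fun i =>
    hST _ (v (i + 1)).1.2 fun h => hcyc 0 (i + 1) (Nat.succ_pos i)
      (Subtype.ext (h0.trans (hpole _ h).symm))
  have hmem : ∀ i, (v (i + 1)).1.1 ∈ S ×ˢ T := by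
    intro i
    induction i with
    | zero =>
      rcases h1 with h | h
      · exact ⟨h, (hiff 0).1 h⟩
      · exact ⟨(hiff 0).2 h, h⟩
    | succ i ih =>
      rcases (hpath (i + 1)).2 with h | h
      · have : (v (i + 1 + 1)).1.1.1 ∈ S := h ▸ ih.1
        exact ⟨this, (hiff (i + 1)).1 this⟩
      · have : (v (i + 1 + 1)).1.1.2 ∈ T := h ▸ ih.2
        exact ⟨(hiff (i + 1)).2 this, this⟩
  refine Set.infinite_of_injective_forall_mem (fun i j hij => ?_) hmem (hS.prod hT)
  by_contra hne
  have e : v (i + 1) = v (j + 1) := Subtype.ext (Subtype.ext hij)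
  rcases lt_or_gt_of_ne hne with h | h
  · exact hcyc _ _ (Nat.succ_lt_succ h) e
  · exact hcyc _ _ (Nat.succ_lt_succ h) e.symm

end SepVar

theorem mainTheorem11 {K : Type*} [Field K] [IsAlgClosed K] [CharZero K]
    (p : SepVar.Poly K) (hp : Irreducible p)
    (hpx : p.degreeOf 0 ≠ 0) (hpy : p.degreeOf 1 ≠ 0)
    (r : SepVar.Rat2 K)
    (s : SepVar.curve p) (hs : SepVar.IsPole r p s)
    (v w : ℕ → SepVar.orbit p s)
    (hv : SepVar.IsAdmissiblePath r p s v) (hw : SepVar.IsAdmissiblePath r p s w)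
    (hv1 : (v 1).1.1.1 = s.1.1) (hw1 : (w 1).1.1.2 = s.1.2) :
    SepVar.F r p = ∅ := by
  rw [Set.eq_empty_iff_forall_notMem]
  intro fg hfg
  obtain ⟨S, T, hS, hT, hpole, hnon⟩ := SepVar.exists_finite_poles_of_mem_F hp hpx hpy hfg
  rcases hpole _ hs with h | h
  · exact hv.false_of_finite hS hT hnon (Or.inl (hv1 ▸ h))
  · exact hw.false_of_finite hS hT hnon (Or.inr (hw1 ▸ h))
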